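/- Let $d,m$ be natural numbers, $\mathbb{E}=\mathbb{R}^d\times\{1,\dots,m\}$, and let $C_R\subset\mathbb{R}^d$ be the open cube of edge length $R$ centred at $0$, of Lebesgue measure $\ell(C_R)$. A point measure on $\mathbb{E}$ is a Borel measure taking finite, natural number values on all relatively compact Borel sets; it is $r$-uniformly discrete if $\lambda((a+C_r)\times\{1,\dots,m\})\le 1$ for all $a\in\mathbb{R}^d$. An $m$-coloured stationary, uniformly discrete, ergodic point process is given by its law $\mu$: a probability measure on the space of measures on $\mathbb{E}$ (with the $\sigma$-algebra generated by the evaluations $\lambda\mapsto\lambda(A)$) that is concentrated on the $r$-uniformly discrete point measures for some $r>0$, and is invariant and ergodic under the translations $(T_t\lambda)(A)=\lambda(-t+A)$, $t\in\mathbb{R}^d$, which act on $\mathbb{E}$ by $t+(x,i)=(t+x,i)$. Let $w=(w_1,\dots,w_m)$ be real weights and put $\lambda^w(\{x\})=\sum_{i=1}^m w_i\,\lambda(\{(x,i)\})$ for $x\in\mathbb{R}^d$. For $n\ge 1$ the weighted $(n+1)$-point correlation of $\lambda$ is the Radon measure $\gamma^{(n+1)}_\lambda$ on $(\mathbb{R}^d)^n$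 given by $$\gamma^{(n+1)}_\lambda(f)=\lim_{R\to\infty}\frac{1}{\ell(C_R)}\sum_{x,y_1,\dots,y_n\in C_R}\lambda^w(\{x\})\prod_{j=1}^n\lambda^w(\{y_j\})\,f(y_1-x,\dots,y_n-x)\qquad\text{for all } f\in C_c((\mathbb{R}^d)^n),$$ if these limits exist and define a Radon measure. Theorem. Suppose that the weights $w_1,\dots,w_m$ are pairwise distinct and all nonzero. Then $\mu$ is completely determined by the weighted $(n+1)$-point correlations, $n=1,2,\dots$, of $\mu$-almost every $\lambda$. That is, for every $m$-coloured stationary, uniformly discrete, ergodic point process $\mu$ there are Radon measures $\gamma^{(n+1)}$ on $(\mathbb{R}^d)^n$, $n\ge1$, such that for $\mu$-almost every $\lambda$ the correlations $\gamma_\lambda^{(n+1)}$ exist and equal $\gamma^{(n+1)}$ for all $n\ge1$; and if $\nu$ is any $m$-coloured stationary, uniformly discrete, ergodic point process on $\mathbb{R}^d$ such that the set of $\lambda$ with $\gamma^{(n+1)}_\lambda=\gamma^{(n+1)}$ for all $n\ge1$ is not $\nu$-null, then $\nu=\mu$. -/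

import Mathlib

open MeasureTheory Filter Topology
open scoped CompactlySupported

noncomputable section

namespace ColouredPointProcess

/-- The ambient space `ℝ^d` with the Euclidean metric. -/
abbrev Pos (d : ℕ) : Type := EuclideanSpace ℝ (Fin d)

/-- The space `𝔼 = ℝ^d × {1, …, m}` of coloured points. -/
abbrev ColPt (d m : ℕ) : Type := Pos d × Fin m

/-- The open cube `C_R` of edge length `R` about `0`. -/
def cube (d : ℕ) (R : ℝ) : Set (Pos d) := {x | ∀ k, |x k| < R / 2}

/-- The translation `(x, i) ↦ (t + x, i)` of coloured points. -/
def shift {d m : ℕ} (t : Pos d) (p : ColPt d m) : ColPt d m := (t + p.1, p.2)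

/-- The induced translation of measures, `(T_t lam)(A) = lam (-t + A)`. -/
def shiftMeasure {d m : ℕ} (t : Pos d) (lam : Measure (ColPt d m)) : Measure (ColPt d m) :=
  lam.map (shift t)

/-- Point measures: `lam A` is a (finite) natural number for every relatively compact Borel set. -/
def IsPointMeasure {d m : ℕ} (lam : Measure (ColPt d m)) : Prop :=
  ∀ A : Set (ColPt d m), MeasurableSet A → IsCompact (closure A) → ∃ k : ℕ, lam A = k

/-- The set of `r`-uniformly discrete point measures: every translate of the cube of edge
length `r` carries at most one point, all colours counted together. -/
def uniformlyDiscrete (d m : ℕ) (r : ℝ) : Set (Measure (ColPt d m)) :=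
  {lam | IsPointMeasure lam ∧ ∀ a : Pos d, lam {p | p.1 - a ∈ cube d r} ≤ 1}

/-- `μ` is the law of an `m`-coloured, stationary, uniformly discrete, ergodic point process
on `ℝ^d`. The space of measures carries the `σ`-algebra generated by the evaluations
`lam ↦ lam A`. -/
structure IsProcess {d m : ℕ} (μ : Measure (Measure (ColPt d m))) : Prop where
  prob : IsProbabilityMeasure μ
  unifDiscrete : ∃ r : ℝ, 0 < r ∧ ∀ᵐ lam ∂μ, lam ∈ uniformlyDiscrete d m r
  stationary : ∀ t : Pos d, MeasurePreserving (shiftMeasure t) μ μ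
  ergodic : ∀ D : Set (Measure (ColPt d m)), MeasurableSet D →
    (∀ t : Pos d, shiftMeasure t ⁻¹' D = D) → μ D = 0 ∨ μ D = 1

/-- The mass `lam^w({x})` of the weighted measure `lam^w = ∑ᵢ wᵢ lamⁱ` on `ℝ^d`. -/
def weightAt {d m : ℕ} (w : Fin m → ℝ) (lam : Measure (ColPt d m)) (x : Pos d) : ℝ :=
  ∑ i, w i * lam.real {(x, i)}

/-- The sum
`∑_{x, y₁, …, yₙ ∈ C_R} lam^w({x}) ∏ⱼ lam^w({yⱼ}) f (y₁ - x, …, yₙ - x)`.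
For a uniformly discrete `lam` it has only finitely many nonzero terms. -/
def corrSum {d m : ℕ} (w : Fin m → ℝ) (lam : Measure (ColPt d m)) (n : ℕ) (R : ℝ)
    (f : (Fin n → Pos d) → ℂ) : ℂ :=
  ∑ᶠ x ∈ cube d R, ∑ᶠ y ∈ {y : Fin n → Pos d | ∀ j, y j ∈ cube d R},
    ((weightAt w lam x * ∏ j, weightAt w lam (y j) : ℝ) : ℂ) * f (fun j => y j - x)

/-- A complex Radon measure on `S`, viewed as a linear functional on `C_c(S)`: on the functions
supported in a fixed compact set it is bounded with respect to the sup norm. -/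
def IsRadonFunctional {S : Type*} [TopologicalSpace S] (γ : C_c(S, ℂ) →ₗ[ℂ] ℂ) : Prop :=
  ∀ K : Set S, IsCompact K → ∃ C : ℝ, ∀ f : C_c(S, ℂ), tsupport f ⊆ K →
    ∀ B : ℝ, (∀ s, ‖f s‖ ≤ B) → ‖γ f‖ ≤ C * B

/-- The weighted `(n+1)`-point correlation of `lam` exists and is the measure `γ` on `(ℝ^d)^n`. -/
structure IsCorrelation {d m : ℕ} (w : Fin m → ℝ) (lam : Measure (ColPt d m)) (n : ℕ)
    (γ : C_c(Fin n → Pos d, ℂ) →ₗ[ℂ] ℂ) : Prop where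
  radon : IsRadonFunctional γ
  tendsto : ∀ f : C_c(Fin n → Pos d, ℂ),
    Tendsto (fun R : ℝ => corrSum w lam n R f / ((volume.real (cube d R) : ℝ) : ℂ))
      atTop (𝓝 (γ f))

end ColouredPointProcess

end

open ColouredPointProcess

/-!
The ergodic theorem for `ℤ^d`, obtained by iterating Maker's extension of Birkhoff's theorem one
coordinate at a time, gives the almost sure correlations: the correlation at `f` is the mean of the
sum of `f (y₁ - x, …, yₙ - x)` over the weighted points with `x` in the unit cell `[0, 1)^d`.
Ergodicity is only assumed under `ℝ^d`, but the limits are nevertheless constant, since a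
translation changes the sum over a large box only near the boundary of the box.

Conversely, by stationarity, the correlations determine the mean of every sum
`∑ lam^w({x₀}) ⋯ lam^w({xₙ}) G (x₀, …, xₙ)` with `n ≥ 1`. Products of such sums are again such sums,
so all their moments are determined, and hence, as they are bounded, all their characteristic
functions. Letting `G` charge only tuples near the diagonal produces the sums
`∑ lam^w({x}) ^ k f x` with `k ≥ 2`. As the weights are distinct and nonzero, interpolation in
`lam^w({x})` recovers the colour of every point, so the integrals `∫ f dlam` are among the
determined random variables, and these determine the law of `lam`.
-/

noncomputable section

section PointwiseErgodic

variable {Ω : Type*}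

/-- The running maximum `max(0, S₁, …, Sₙ)` of the Birkhoff sums of `g`, defined by the recursion
that drives the proof of the maximal ergodic theorem. -/
def birkhoffMax (T : Ω → Ω) (g : Ω → ℝ) : ℕ → Ω → ℝ
  | 0 => fun _ => 0
  | n + 1 => fun x => max 0 (g x + birkhoffMax T g n (T x))

lemma birkhoffMax_nonneg (T : Ω → Ω) (g : Ω → ℝ) (n : ℕ) (x : Ω) : 0 ≤ birkhoffMax T g n x := by
  cases n <;> simp [birkhoffMax]

lemma birkhoffMax_le_succ (T : Ω → Ω) (g : Ω → ℝ) (n : ℕ) (x : Ω) :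
    birkhoffMax T g n x ≤ birkhoffMax T g (n + 1) x := by
  induction n generalizing x with
  | zero => exact birkhoffMax_nonneg T g 1 x
  | succ n ih => exact max_le_max le_rfl (add_le_add le_rfl (ih (T x)))

lemma birkhoffSum_le_birkhoffMax (T : Ω → Ω) (g : Ω → ℝ) (n : ℕ) (x : Ω) :
    birkhoffSum T g n x ≤ birkhoffMax T g n x := by
  induction n generalizing x with
  | zero => simp [birkhoffMax]
  | succ n ih =>
    rw [birkhoffSum_succ']
    exact (add_le_add le_rfl (ih (T x))).trans (le_max_right _ _)

lemma birkhoffMax_succ_sub (T : Ω → Ω) (g : Ω → ℝ) (n : ℕ) (x : Ω) :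
    birkhoffMax T g (n + 1) x - birkhoffMax T g n (T x) = max (-birkhoffMax T g n (T x)) (g x) := by
  rw [birkhoffMax, ← max_sub_sub_right, zero_sub, add_sub_cancel_right]

lemma abs_birkhoffMax_succ_sub_le (T : Ω → Ω) (g : Ω → ℝ) (n : ℕ) (x : Ω) :
    |birkhoffMax T g (n + 1) x - birkhoffMax T g n (T x)| ≤ |g x| := by
  rw [birkhoffMax_succ_sub]
  have hM := birkhoffMax_nonneg T g n (T x)
  exact abs_le.2 ⟨(neg_abs_le _).trans (le_max_right _ _),
    max_le (by linarith [abs_nonneg (g x)]) (le_abs_self _)⟩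

/-- The points at which the Birkhoff sums of `g` are unbounded above: the invariant set to which the
maximal ergodic theorem is applied. -/
def birkhoffUnbounded (T : Ω → Ω) (g : Ω → ℝ) : Set Ω :=
  {x | ¬ BddAbove (Set.range fun n => birkhoffSum T g n x)}

lemma preimage_birkhoffUnbounded (T : Ω → Ω) (g : Ω → ℝ) :
    T ⁻¹' birkhoffUnbounded T g = birkhoffUnbounded T g := by
  ext x
  refine not_congr ⟨?_, ?_⟩ <;> rintro ⟨C, hC⟩
  · refine ⟨max 0 (g x + C), ?_⟩
    rintro _ ⟨_ | n, rfl⟩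
    · simp
    · simp only [birkhoffSum_succ']
      exact le_max_of_le_right (add_le_add le_rfl (hC ⟨n, rfl⟩))
  · refine ⟨C - g x, ?_⟩
    rintro _ ⟨n, rfl⟩
    have := hC ⟨n + 1, rfl⟩
    simp only [birkhoffSum_succ'] at this
    linarith

lemma eventually_birkhoffMax_succ_sub_eq {T : Ω → Ω} {g : Ω → ℝ} {x : Ω}
    (hx : x ∈ birkhoffUnbounded T g) :
    ∀ᶠ n in atTop, birkhoffMax T g (n + 1) x - birkhoffMax T g n (T x) = g x := by
  rw [← preimage_birkhoffUnbounded] at hx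
  obtain ⟨_, ⟨n, rfl⟩, hn⟩ := not_bddAbove_iff.1 hx (-g x)
  have hmono : Monotone fun n => birkhoffMax T g n (T x) :=
    monotone_nat_of_le_succ fun n => birkhoffMax_le_succ T g n (T x)
  filter_upwards [eventually_ge_atTop n] with k hk
  have hlarge : -g x < birkhoffMax T g k (T x) :=
    hn.trans_le ((birkhoffSum_le_birkhoffMax T g n (T x)).trans (hmono hk))
  rw [birkhoffMax_succ_sub, max_eq_right (by linarith)]

variable [MeasurableSpace Ω] {μ : Measure Ω} {T : Ω → Ω}

lemma measurable_birkhoffSum (hT : Measurable T) {g : Ω → ℝ} (hg : Measurable g) (n : ℕ) :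
    Measurable (birkhoffSum T g n) :=
  Finset.measurable_sum _ fun k _ => hg.comp (hT.iterate k)

lemma measurableSet_birkhoffUnbounded (hT : Measurable T) {g : Ω → ℝ} (hg : Measurable g) :
    MeasurableSet (birkhoffUnbounded T g) :=
  (measurableSet_bddAbove_range fun n => measurable_birkhoffSum hT hg n).compl

lemma integrable_birkhoffMax (hT : MeasurePreserving T μ μ) {g : Ω → ℝ} (hg : Integrable g μ)
    (n : ℕ) : Integrable (birkhoffMax T g n) μ := by
  induction n with
  | zero => exact integrable_zero _ _ _
  | succ n ih =>
    exact (integrable_zero _ _ _).sup (hg.add (hT.integrable_comp_of_integrable ih))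

lemma setIntegral_birkhoffMax_succ_sub_nonneg (hT : MeasurePreserving T μ μ) {g : Ω → ℝ}
    (hg : Integrable g μ) {s : Set Ω} (hs : MeasurableSet s) (hTs : T ⁻¹' s = s) (n : ℕ) :
    0 ≤ ∫ x in s, (birkhoffMax T g (n + 1) x - birkhoffMax T g n (T x)) ∂μ := by
  have hint := integrable_birkhoffMax hT hg
  have hrestrict : MeasurePreserving T (μ.restrict s) (μ.restrict s) := by
    simpa only [hTs] using hT.restrict_preimage hs
  have hcomp : ∫ x in s, birkhoffMax T g n (T x) ∂μ = ∫ x in s, birkhoffMax T g n x ∂μ := by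
    have hmeas : AEStronglyMeasurable (birkhoffMax T g n) ((μ.restrict s).map T) := by
      rw [hrestrict.map_eq]; exact (hint n).aestronglyMeasurable.restrict
    rw [← integral_map hrestrict.measurable.aemeasurable hmeas, hrestrict.map_eq]
  have hintT : Integrable (fun x => birkhoffMax T g n (T x)) μ :=
    hT.integrable_comp_of_integrable (hint n)
  rw [integral_sub (hint (n + 1)).integrableOn hintT.integrableOn, hcomp, sub_nonneg]
  exact integral_mono (hint n).integrableOn (hint (n + 1)).integrableOn
    (birkhoffMax_le_succ T g n)

/-- The maximal ergodic theorem. On the set in question the increments `Mₙ₊₁ - Mₙ ∘ T` of the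
running maxima converge to `g`, while their integrals are nonnegative because `Mₙ ≤ Mₙ₊₁`. -/
theorem setIntegral_birkhoffUnbounded_nonneg (hT : MeasurePreserving T μ μ) {g : Ω → ℝ}
    (hgm : Measurable g) (hg : Integrable g μ) : 0 ≤ ∫ x in birkhoffUnbounded T g, g x ∂μ := by
  have hBm := measurableSet_birkhoffUnbounded hT.measurable hgm
  have hint := integrable_birkhoffMax hT hg
  have hlim : Tendsto (fun n => ∫ x in birkhoffUnbounded T g,
      (birkhoffMax T g (n + 1) x - birkhoffMax T g n (T x)) ∂μ)
      atTop (𝓝 (∫ x in birkhoffUnbounded T g, g x ∂μ)) :=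
    tendsto_integral_of_dominated_convergence (fun x => |g x|)
      (fun n => ((hint (n + 1)).sub
        (hT.integrable_comp_of_integrable (hint n))).aestronglyMeasurable.restrict)
      hg.abs.integrableOn
      (fun n => Eventually.of_forall (abs_birkhoffMax_succ_sub_le T g n))
      ((ae_restrict_mem hBm).mono fun x hx =>
        tendsto_const_nhds.congr' (EventuallyEq.symm (eventually_birkhoffMax_succ_sub_eq hx)))
  exact ge_of_tendsto' hlim fun n =>
    setIntegral_birkhoffMax_succ_sub_nonneg hT hg hBm (preimage_birkhoffUnbounded T g) n

lemma measure_birkhoffUnbounded_sub_condExp [IsFiniteMeasure μ] (hT : MeasurePreserving T μ μ)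
    {f : Ω → ℝ} (hfm : Measurable f) (hf : Integrable f μ) {ε : ℝ} (hε : 0 < ε) :
    μ (birkhoffUnbounded T (f - μ[f | MeasurableSpace.invariants T] - fun _ => ε)) = 0 := by
  have hle := MeasurableSpace.invariants_le T
  set F := μ[f | MeasurableSpace.invariants T]
  set B := birkhoffUnbounded T (f - F - fun _ => ε)
  have hgm : Measurable (f - F - fun _ => ε) :=
    (hfm.sub (stronglyMeasurable_condExp.measurable.mono hle le_rfl)).sub measurable_const
  have hFi : Integrable F μ := integrable_condExp
  have hBm : MeasurableSet B := measurableSet_birkhoffUnbounded hT.measurable hgm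
  have hF : ∫ x in B, F x ∂μ = ∫ x in B, f x ∂μ :=
    setIntegral_condExp hle hf ⟨hBm, preimage_birkhoffUnbounded T _⟩
  have hint : ∫ x in B, (f x - F x - ε) ∂μ = -(μ.real B * ε) := by
    rw [integral_sub (f := fun x => f x - F x) (hf.sub hFi).integrableOn
      (integrable_const _).integrableOn,
      integral_sub hf.integrableOn hFi.integrableOn, hF, setIntegral_const]
    simp
  have hnonneg : 0 ≤ -(μ.real B * ε) := hint ▸
    setIntegral_birkhoffUnbounded_nonneg hT hgm ((hf.sub hFi).sub (integrable_const _))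
  have hzero : μ.real B = 0 := by nlinarith [measureReal_nonneg (μ := μ) (s := B)]
  exact (measureReal_eq_zero_iff).1 hzero

lemma ae_eventually_birkhoffAverage_le [IsFiniteMeasure μ] (hT : MeasurePreserving T μ μ)
    {f : Ω → ℝ} (hfm : Measurable f) (hf : Integrable f μ) {ε : ℝ} (hε : 0 < ε) :
    ∀ᵐ x ∂μ, ∀ᶠ n : ℕ in atTop,
      birkhoffAverage ℝ T f n x ≤ (μ[f | MeasurableSpace.invariants T]) x + ε := by
  have hnull := measure_eq_zero_iff_ae_notMem.1
    (measure_birkhoffUnbounded_sub_condExp hT hfm hf (half_pos hε))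
  set F := μ[f | MeasurableSpace.invariants T]
  have hFT : F ∘ T = F := MeasurableSpace.comp_eq_of_measurable_invariants
    stronglyMeasurable_condExp.measurable
  filter_upwards [hnull] with x hx
  obtain ⟨C, hC⟩ := not_not.1 hx
  filter_upwards [eventually_gt_atTop 0, tendsto_natCast_atTop_atTop.eventually_ge_atTop
    (2 * C / ε)] with n hn0 hn
  have hsum := hC ⟨n, rfl⟩
  simp only [birkhoffSum_sub, birkhoffSum_of_comp_eq hFT, Pi.smul_apply,
    birkhoffSum_of_comp_eq (f := T) (φ := fun _ : Ω => ε / 2) rfl, nsmul_eq_mul] at hsum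
  rw [div_le_iff₀ hε] at hn
  rw [birkhoffAverage, smul_eq_mul, inv_mul_le_iff₀ (by exact_mod_cast hn0)]
  linarith

lemma ae_tendsto_birkhoffAverage_of_measurable [IsFiniteMeasure μ] (hT : MeasurePreserving T μ μ)
    {f : Ω → ℝ} (hfm : Measurable f) (hf : Integrable f μ) :
    ∀ᵐ x ∂μ, Tendsto (fun n => birkhoffAverage ℝ T f n x) atTop
      (𝓝 ((μ[f | MeasurableSpace.invariants T]) x)) := by
  have hupper := ae_all_iff.2 fun j : ℕ =>
    ae_eventually_birkhoffAverage_le hT hfm hf (Nat.one_div_pos_of_nat (α := ℝ) (n := j))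
  have hlower := ae_all_iff.2 fun j : ℕ =>
    ae_eventually_birkhoffAverage_le hT hfm.neg hf.neg (Nat.one_div_pos_of_nat (α := ℝ) (n := j))
  filter_upwards [hupper, hlower, condExp_neg f (MeasurableSpace.invariants T)]
    with x hup hlo hneg
  refine Metric.tendsto_nhds.2 fun ε hε => ?_
  obtain ⟨j, hj⟩ := exists_nat_one_div_lt hε
  filter_upwards [hup j, hlo j] with n hn hn'
  rw [birkhoffAverage_neg, hneg] at hn'
  simp only [Pi.neg_apply] at hn'
  rw [Real.dist_eq, abs_lt]
  constructor <;> linarith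

theorem ae_tendsto_birkhoffAverage [IsFiniteMeasure μ] (hT : MeasurePreserving T μ μ)
    {f : Ω → ℝ} (hf : Integrable f μ) :
    ∀ᵐ x ∂μ, Tendsto (fun n => birkhoffAverage ℝ T f n x) atTop
      (𝓝 ((μ[f | MeasurableSpace.invariants T]) x)) := by
  obtain ⟨g, hgm, hfg⟩ := hf.aemeasurable
  have haverage := ae_all_iff.2 fun n =>
    hT.quasiMeasurePreserving.birkhoffAverage_ae_eq_of_ae_eq ℝ hfg n
  filter_upwards [ae_tendsto_birkhoffAverage_of_measurable hT hgm (hf.congr hfg), haverage,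
    condExp_congr_ae (m := MeasurableSpace.invariants T) hfg] with x hx hav hcond
  simpa only [hav, hcond] using hx

end PointwiseErgodic

section Maker

variable {Ω : Type*}

/-- The error `sup_{n ≥ N} |Φₙ - f|` of a sequence of functions against its limit. -/
def tailSup (Φ : ℕ → Ω → ℝ) (f : Ω → ℝ) (N : ℕ) (x : Ω) : ℝ := ⨆ n, |Φ (N + n) x - f x|

variable {Φ : ℕ → Ω → ℝ} {f : Ω → ℝ} {x : Ω}

lemma tailSup_nonneg (N : ℕ) : 0 ≤ tailSup Φ f N x := Real.iSup_nonneg fun _ => abs_nonneg _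

lemma tailSup_le {c : ℝ} {N : ℕ} (h : ∀ n, N ≤ n → |Φ n x - f x| ≤ c) : tailSup Φ f N x ≤ c :=
  ciSup_le fun n => h (N + n) (Nat.le_add_right N n)

lemma abs_sub_le_tailSup {c : ℝ} (h : ∀ n, |Φ n x - f x| ≤ c) {N n : ℕ} (hn : N ≤ n) :
    |Φ n x - f x| ≤ tailSup Φ f N x := by
  obtain ⟨k, rfl⟩ := Nat.exists_eq_add_of_le hn
  exact le_ciSup (f := fun k => |Φ (N + k) x - f x|)
    ⟨c, by rintro _ ⟨k, rfl⟩; exact h (N + k)⟩ k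

lemma antitone_tailSup {c : ℝ} (h : ∀ n, |Φ n x - f x| ≤ c) :
    Antitone fun N => tailSup Φ f N x :=
  fun _ _ hNM => tailSup_le fun _ hn => abs_sub_le_tailSup h (hNM.trans hn)

lemma tendsto_tailSup (h : Tendsto (fun n => Φ n x) atTop (𝓝 (f x))) :
    Tendsto (fun N => tailSup Φ f N x) atTop (𝓝 0) := by
  refine Metric.tendsto_nhds.2 fun ε hε => ?_
  obtain ⟨N, hN⟩ := Metric.tendsto_atTop.1 h (ε / 2) (half_pos hε)
  filter_upwards [eventually_ge_atTop N] with M hM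
  rw [Real.dist_0_eq_abs, abs_of_nonneg (tailSup_nonneg M)]
  exact (tailSup_le fun n hn => (hN n (hM.trans hn)).le).trans_lt (half_lt_self hε)

variable {m₀ : MeasurableSpace Ω} {μ : Measure Ω}

lemma aemeasurable_tailSup (hΦ : ∀ n, AEMeasurable (Φ n) μ) (hf : AEMeasurable f μ) (N : ℕ) :
    AEMeasurable (tailSup Φ f N) μ :=
  AEMeasurable.iSup fun n => ((hΦ (N + n)).sub hf).abs

lemma ae_abs_sub_le_of_dominated {h : Ω → ℝ} (hΦh : ∀ n, ∀ᵐ x ∂μ, |Φ n x| ≤ h x)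
    (hlim : ∀ᵐ x ∂μ, Tendsto (fun n => Φ n x) atTop (𝓝 (f x))) :
    ∀ᵐ x ∂μ, |f x| ≤ h x ∧ ∀ n, |Φ n x - f x| ≤ 2 * h x := by
  filter_upwards [ae_all_iff.2 hΦh, hlim] with x hx hxlim
  have hfx : |f x| ≤ h x := le_of_tendsto' hxlim.abs hx
  exact ⟨hfx, fun n => (abs_sub _ _).trans (by linarith [hx n])⟩

lemma integrable_tailSup {h : Ω → ℝ} (hΦ : ∀ n, AEMeasurable (Φ n) μ) (hh : Integrable h μ)
    (hΦh : ∀ n, ∀ᵐ x ∂μ, |Φ n x| ≤ h x)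
    (hlim : ∀ᵐ x ∂μ, Tendsto (fun n => Φ n x) atTop (𝓝 (f x))) (N : ℕ) :
    Integrable (tailSup Φ f N) μ := by
  have hf := aemeasurable_of_tendsto_metrizable_ae' hΦ hlim
  refine (hh.const_mul 2).mono' (aemeasurable_tailSup hΦ hf N).aestronglyMeasurable ?_
  filter_upwards [ae_abs_sub_le_of_dominated hΦh hlim] with x hx
  rw [Real.norm_eq_abs, abs_of_nonneg (tailSup_nonneg N)]
  exact tailSup_le fun n _ => hx.2 n

lemma tendsto_integral_tailSup {h : Ω → ℝ} (hΦ : ∀ n, AEMeasurable (Φ n) μ) (hh : Integrable h μ)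
    (hΦh : ∀ n, ∀ᵐ x ∂μ, |Φ n x| ≤ h x)
    (hlim : ∀ᵐ x ∂μ, Tendsto (fun n => Φ n x) atTop (𝓝 (f x))) :
    Tendsto (fun N => ∫ x, tailSup Φ f N x ∂μ) atTop (𝓝 0) := by
  have hbound : ∀ N, ∀ᵐ x ∂μ, ‖tailSup Φ f N x‖ ≤ 2 * h x := fun N => by
    filter_upwards [ae_abs_sub_le_of_dominated hΦh hlim] with x hx
    rw [Real.norm_eq_abs, abs_of_nonneg (tailSup_nonneg N)]
    exact tailSup_le fun n _ => hx.2 n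
  have := tendsto_integral_of_dominated_convergence _
    (fun N => (integrable_tailSup hΦ hh hΦh hlim N).aestronglyMeasurable) (hh.const_mul 2) hbound
    (hlim.mono fun x hx => tendsto_tailSup hx)
  simpa using this

lemma ae_tendsto_condExp_tailSup {m : MeasurableSpace Ω} (hm : m ≤ m₀)
    [SigmaFinite (μ.trim hm)] {h : Ω → ℝ} (hΦ : ∀ n, AEMeasurable (Φ n) μ)
    (hh : Integrable h μ) (hΦh : ∀ n, ∀ᵐ x ∂μ, |Φ n x| ≤ h x)
    (hlim : ∀ᵐ x ∂μ, Tendsto (fun n => Φ n x) atTop (𝓝 (f x))) :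
    ∀ᵐ x ∂μ, Tendsto (fun N => (μ[tailSup Φ f N | m]) x) atTop (𝓝 0) := by
  have hint := integrable_tailSup hΦ hh hΦh hlim
  refine tendsto_of_integral_tendsto_of_antitone (fun N => integrable_condExp)
    (integrable_zero Ω ℝ μ) ?_ ?_ ?_
  · simpa only [integral_condExp hm, integral_zero] using
      tendsto_integral_tailSup hΦ hh hΦh hlim
  · have hsucc : ∀ N, μ[tailSup Φ f (N + 1) | m] ≤ᵐ[μ] μ[tailSup Φ f N | m] := fun N =>
      condExp_mono (hint (N + 1)) (hint N) <| by
        filter_upwards [ae_abs_sub_le_of_dominated hΦh hlim] with x hx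
        exact antitone_tailSup hx.2 N.le_succ
    filter_upwards [ae_all_iff.2 hsucc] with x hx using antitone_nat_of_succ_le hx
  · exact ae_all_iff.2 fun N => condExp_nonneg (Eventually.of_forall fun x => tailSup_nonneg N)

/-- Maker's ergodic theorem. -/
theorem ae_tendsto_birkhoffAverage_of_ae_tendsto [IsFiniteMeasure μ] {T : Ω → Ω}
    (hT : MeasurePreserving T μ μ) {h : Ω → ℝ} (hΦ : ∀ n, AEMeasurable (Φ n) μ)
    (hh : Integrable h μ) (hΦh : ∀ n, ∀ᵐ x ∂μ, |Φ n x| ≤ h x)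
    (hlim : ∀ᵐ x ∂μ, Tendsto (fun n => Φ n x) atTop (𝓝 (f x))) :
    ∀ᵐ x ∂μ, Tendsto (fun n => birkhoffAverage ℝ T (Φ n) n x) atTop
      (𝓝 ((μ[f | MeasurableSpace.invariants T]) x)) := by
  have hle := MeasurableSpace.invariants_le T
  have hdom := ae_abs_sub_le_of_dominated hΦh hlim
  have hf : Integrable f μ := hh.mono'
    (aemeasurable_of_tendsto_metrizable_ae' hΦ hlim).aestronglyMeasurable
    (hdom.mono fun x hx => hx.1)
  have horbit := ae_all_iff.2 fun k : ℕ => (hT.iterate k).quasiMeasurePreserving.ae hdom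
  filter_upwards [horbit, ae_tendsto_birkhoffAverage hT hf,
    ae_tendsto_condExp_tailSup hle hΦ hh hΦh hlim, ae_all_iff.2 fun N =>
    ae_tendsto_birkhoffAverage hT (integrable_tailSup hΦ hh hΦh hlim N)]
    with x hx hxf hxG hxN
  suffices Tendsto (fun n => birkhoffAverage ℝ T (Φ n) n x - birkhoffAverage ℝ T f n x)
      atTop (𝓝 0) by simpa using this.add hxf
  refine Metric.tendsto_nhds.2 fun ε hε => ?_
  obtain ⟨N, hN⟩ := (hxG.eventually_lt_const hε).exists
  filter_upwards [(hxN N).eventually_lt_const hN, eventually_ge_atTop N] with n hn hNn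
  rw [Real.dist_0_eq_abs]
  refine lt_of_le_of_lt ?_ hn
  simp only [birkhoffAverage, birkhoffSum, smul_eq_mul, ← mul_sub, ← Finset.sum_sub_distrib,
    abs_mul, abs_inv, Nat.abs_cast]
  gcongr
  exact (Finset.abs_sum_le_sum_abs _ _).trans
    (Finset.sum_le_sum fun k _ => abs_sub_le_tailSup (hx k).2 hNn)

end Maker

section LatticeActions

variable {Ω : Type*} [MeasurableSpace Ω] {μ : Measure Ω}

/-- An action of the additive monoid `G` on `Ω` by measure-preserving maps, given by the family of
its maps `τ g`. -/
structure IsMeasurePreservingAction {G : Type*} [AddMonoid G] (τ : G → Ω → Ω) (μ : Measure Ω) :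
    Prop where
  measurePreserving : ∀ g, MeasurePreserving (τ g) μ μ
  zero_apply : ∀ x, τ 0 x = x
  add_apply : ∀ g h x, τ (g + h) x = τ g (τ h x)

namespace IsMeasurePreservingAction

variable {G H : Type*}

lemma comp [AddMonoid G] [AddMonoid H] {τ : G → Ω → Ω} (hτ : IsMeasurePreservingAction τ μ)
    (φ : H →+ G) : IsMeasurePreservingAction (fun h => τ (φ h)) μ where
  measurePreserving h := hτ.measurePreserving (φ h)
  zero_apply x := by rw [map_zero, hτ.zero_apply]
  add_apply g h x := by rw [map_add, hτ.add_apply]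

lemma neg_apply_apply [AddGroup G] {τ : G → Ω → Ω} (hτ : IsMeasurePreservingAction τ μ) (g : G)
    (x : Ω) : τ (-g) (τ g x) = x := by
  rw [← hτ.add_apply, neg_add_cancel, hτ.zero_apply]

lemma iterate_apply [AddMonoid G] {τ : G → Ω → Ω} (hτ : IsMeasurePreservingAction τ μ) (g : G)
    (k : ℕ) (x : Ω) : (τ g)^[k] x = τ (k • g) x := by
  induction k with
  | zero => rw [Function.iterate_zero_apply, zero_nsmul, hτ.zero_apply]
  | succ k ih => rw [Function.iterate_succ_apply', ih, ← hτ.add_apply, succ_nsmul']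

end IsMeasurePreservingAction

lemma sum_Ico_neg_natCast {M : Type*} [AddCommMonoid M] (f : ℤ → M) (n : ℕ) :
    ∑ a ∈ Finset.Ico (-(n : ℤ)) n, f a =
      ∑ k ∈ Finset.range n, f k + ∑ k ∈ Finset.range n, f (-k - 1) := by
  induction n with
  | zero => simp
  | succ n ih =>
    have hIco : Finset.Ico (-((n + 1 : ℕ) : ℤ)) (n + 1 : ℕ) =
        insert (-(n : ℤ) - 1) (insert (n : ℤ) (Finset.Ico (-(n : ℤ)) n)) := by
      ext a; simp only [Finset.mem_Ico, Finset.mem_insert]; omega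
    rw [hIco, Finset.sum_insert (by simp), Finset.sum_insert (by simp), ih,
      Finset.sum_range_succ, Finset.sum_range_succ]
    abel

lemma exists_ae_tendsto_intAverage [IsFiniteMeasure μ] {σ : ℤ → Ω → Ω}
    (hσ : IsMeasurePreservingAction σ μ) {Φ : ℕ → Ω → ℝ} {f h : Ω → ℝ}
    (hΦ : ∀ n, AEMeasurable (Φ n) μ) (hh : Integrable h μ) (hΦh : ∀ n, ∀ᵐ x ∂μ, |Φ n x| ≤ h x)
    (hlim : ∀ᵐ x ∂μ, Tendsto (fun n => Φ n x) atTop (𝓝 (f x))) :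
    ∃ F : Ω → ℝ, ∀ᵐ x ∂μ, Tendsto
      (fun n : ℕ => (2 * n : ℝ)⁻¹ * ∑ a ∈ Finset.Ico (-(n : ℤ)) n, Φ n (σ a x))
      atTop (𝓝 (F x)) := by
  have hforward := ae_tendsto_birkhoffAverage_of_ae_tendsto (hσ.measurePreserving 1) hΦ hh hΦh hlim
  have hbackward := (hσ.measurePreserving (-1)).quasiMeasurePreserving.ae
    (ae_tendsto_birkhoffAverage_of_ae_tendsto (hσ.measurePreserving (-1)) hΦ hh hΦh hlim)
  refine ⟨fun x => ((μ[f | MeasurableSpace.invariants (σ 1)]) x +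
    (μ[f | MeasurableSpace.invariants (σ (-1))]) (σ (-1) x)) / 2, ?_⟩
  filter_upwards [hforward, hbackward] with x hfw hbw
  refine ((hfw.add hbw).div_const 2).congr fun n => ?_
  simp only [birkhoffAverage, birkhoffSum, hσ.iterate_apply, ← hσ.add_apply, smul_eq_mul,
    nsmul_eq_mul, mul_one, mul_neg, ← sub_eq_add_neg, sum_Ico_neg_natCast (fun a => Φ n (σ a x))]
  ring

/-- The integer points of the box `[-n, n)^d`. -/
def latticeBox (d n : ℕ) : Finset (Fin d → ℤ) := Fintype.piFinset fun _ => Finset.Ico (-(n : ℤ)) n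

lemma card_latticeBox (d n : ℕ) : (latticeBox d n).card = (2 * n) ^ d := by
  rw [latticeBox, Fintype.card_piFinset_const, Int.card_Ico]
  congr 1
  omega

lemma sum_latticeBox_succ {M : Type*} [AddCommMonoid M] (d n : ℕ) (f : (Fin (d + 1) → ℤ) → M) :
    ∑ k ∈ latticeBox (d + 1) n, f k =
      ∑ a ∈ Finset.Ico (-(n : ℤ)) n, ∑ k ∈ latticeBox d n, f (Matrix.vecCons a k) := by
  rw [← Finset.sum_product']
  refine Finset.sum_equiv (Fin.consEquiv fun _ => ℤ).symm (fun k => ?_) fun k _ => ?_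
  · simp [latticeBox, Fin.forall_fin_succ, Fin.tail]
  · simp [Matrix.vecCons]

/-- The average of `f` over the part of an orbit of a `ℤ^d`-action indexed by `[-n, n)^d`. -/
def latticeAverage {d : ℕ} {E : Type*} [AddCommGroup E] [Module ℝ E] (τ : (Fin d → ℤ) → Ω → Ω)
    (f : Ω → E) (n : ℕ) (x : Ω) : E :=
  ((2 * n : ℝ) ^ d)⁻¹ • ∑ k ∈ latticeBox d n, f (τ k x)

section

variable {d : ℕ} {τ : (Fin d → ℤ) → Ω → Ω} {E : Type*} [NormedAddCommGroup E] [NormedSpace ℝ E]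

lemma norm_latticeAverage_le {X : Type*} {τ : (Fin d → ℤ) → X → X} {f : X → E} {B : ℝ}
    (hB : ∀ x, ‖f x‖ ≤ B) (n : ℕ) (x : X) : ‖latticeAverage τ f n x‖ ≤ B := by
  have hsum : ‖∑ k ∈ latticeBox d n, f (τ k x)‖ ≤ (2 * n) ^ d * B := by
    refine (norm_sum_le_of_le _ fun k _ => hB (τ k x)).trans_eq ?_
    rw [Finset.sum_const, card_latticeBox, nsmul_eq_mul]
    push_cast
    rfl
  rw [latticeAverage, norm_smul, norm_inv, Real.norm_of_nonneg (by positivity)]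
  exact inv_mul_le_of_le_mul₀ (by positivity) ((norm_nonneg _).trans (hB x)) hsum

lemma stronglyMeasurable_latticeAverage (hτ : IsMeasurePreservingAction τ μ) {f : Ω → E}
    (hf : StronglyMeasurable f) (n : ℕ) : StronglyMeasurable (latticeAverage τ f n) :=
  (Finset.stronglyMeasurable_fun_sum _ fun k _ =>
    hf.comp_measurable (hτ.measurePreserving k).measurable).const_smul _

lemma integral_latticeAverage (hτ : IsMeasurePreservingAction τ μ) {f : Ω → E}
    (hf : Integrable f μ) {n : ℕ} (hn : n ≠ 0) :
    ∫ x, latticeAverage τ f n x ∂μ = ∫ x, f x ∂μ := by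
  have hk : ∀ k, ∫ x, f (τ k x) ∂μ = ∫ x, f x ∂μ := fun k => by
    have hτk := hτ.measurePreserving k
    rw [← integral_map hτk.measurable.aemeasurable (by rw [hτk.map_eq]; exact hf.1), hτk.map_eq]
  have hint : ∀ k, Integrable (fun x => f (τ k x)) μ := fun k =>
    (hτ.measurePreserving k).integrable_comp_of_integrable hf
  simp only [latticeAverage]
  rw [integral_smul, integral_finsetSum _ fun k _ => hint k]
  simp only [hk, Finset.sum_const, card_latticeBox, ← Nat.cast_smul_eq_nsmul ℝ, smul_smul]
  push_cast
  rw [inv_mul_cancel₀ (by positivity), one_smul]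

end

/-- The pointwise ergodic theorem for `ℤ^d`-actions and bounded functions. The averages over boxes
are iterated one-dimensional averages, so Maker's theorem applies to one coordinate at a time. -/
theorem exists_ae_tendsto_latticeAverage [IsFiniteMeasure μ] {d : ℕ} {τ : (Fin d → ℤ) → Ω → Ω}
    (hτ : IsMeasurePreservingAction τ μ) {f : Ω → ℝ} (hfm : Measurable f) {B : ℝ}
    (hB : ∀ x, ‖f x‖ ≤ B) :
    ∃ F : Ω → ℝ, ∀ᵐ x ∂μ, Tendsto (fun n => latticeAverage τ f n x) atTop (𝓝 (F x)) := by
  induction d with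
  | zero =>
    have hbox : ∀ n, latticeBox 0 n = {0} := fun n => by
      ext k; simp [latticeBox, eq_iff_true_of_subsingleton]
    refine ⟨f, Eventually.of_forall fun x => tendsto_const_nhds.congr fun n => ?_⟩
    rw [latticeAverage, hbox, Finset.sum_singleton, hτ.zero_apply, pow_zero, inv_one, one_smul]
  | succ d ih =>
    let tail : (Fin d → ℤ) →+ (Fin (d + 1) → ℤ) := .mk' (Matrix.vecCons 0) (by simp)
    let head : ℤ →+ (Fin (d + 1) → ℤ) := .mk' (fun a => Matrix.vecCons a 0) (by simp)
    have hsplit : ∀ a k, head a + tail k = Matrix.vecCons a k := by simp [head, tail]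
    have htail := hτ.comp tail
    obtain ⟨F₀, hF₀⟩ := ih htail
    have hmeas := stronglyMeasurable_latticeAverage htail hfm.stronglyMeasurable
    obtain ⟨F, hF⟩ := exists_ae_tendsto_intAverage (hτ.comp head)
      (fun n => (hmeas n).measurable.aemeasurable) (integrable_const B)
      (fun n => Eventually.of_forall (norm_latticeAverage_le hB n)) hF₀
    refine ⟨F, hF.mono fun x hx => hx.congr fun n => ?_⟩
    simp only [latticeAverage, smul_eq_mul, ← hτ.add_apply, add_comm (tail _), hsplit,
      sum_latticeBox_succ, ← Finset.mul_sum, ← mul_assoc, pow_succ', mul_inv]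

lemma exists_ae_tendsto_latticeAverage_complex [IsFiniteMeasure μ] {d : ℕ}
    {τ : (Fin d → ℤ) → Ω → Ω} (hτ : IsMeasurePreservingAction τ μ) {f : Ω → ℂ}
    (hfm : Measurable f) {B : ℝ} (hB : ∀ x, ‖f x‖ ≤ B) :
    ∃ F : Ω → ℂ, ∀ᵐ x ∂μ, Tendsto (fun n => latticeAverage τ f n x) atTop (𝓝 (F x)) := by
  obtain ⟨F, hF⟩ := exists_ae_tendsto_latticeAverage hτ (Complex.measurable_re.comp hfm)
    fun x => (Complex.abs_re_le_norm _).trans (hB x)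
  obtain ⟨F', hF'⟩ := exists_ae_tendsto_latticeAverage hτ (Complex.measurable_im.comp hfm)
    fun x => (Complex.abs_im_le_norm _).trans (hB x)
  refine ⟨fun x => F x + F' x * Complex.I, ?_⟩
  filter_upwards [hF, hF'] with x hx hx'
  refine ((Complex.continuous_ofReal.tendsto _).comp hx |>.add
    (((Complex.continuous_ofReal.tendsto _).comp hx').mul_const Complex.I)).congr fun n => ?_
  simp only [latticeAverage, Function.comp_apply]
  generalize ((2 * n : ℝ) ^ d)⁻¹ = a
  apply Complex.ext <;> simp

lemma limUnder_congr_of_tendsto_iff {X ι : Type*} [TopologicalSpace X] [Nonempty X] {l : Filter ι}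
    {u v : ι → X} (h : ∀ c, Tendsto u l (𝓝 c) ↔ Tendsto v l (𝓝 c)) : limUnder l u = limUnder l v :=
  congrArg Classical.epsilon (funext fun c => propext (h c))

lemma exists_ae_eq_const_of_invariant [IsProbabilityMeasure μ] {G X : Type*} {τ : G → Ω → Ω}
    (hergodic : ∀ D, MeasurableSet D → (∀ g, τ g ⁻¹' D = D) → μ D = 0 ∨ μ D = 1)
    [MeasurableSpace X] [MeasurableSpace.CountablySeparated X] [Nonempty X] {F : Ω → X}
    (hF : Measurable F) (hinv : ∀ g x, F (τ g x) = F x) : ∃ c, F =ᵐ[μ] Function.const Ω c := by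
  refine exists_eventuallyEq_const_of_forall_separating MeasurableSet fun S hS => ?_
  rcases hergodic (F ⁻¹' S) (hF hS) fun g => by ext x; simp [hinv] with h | h
  · exact .inr (measure_eq_zero_iff_ae_notMem.1 h)
  · exact .inl ((mem_ae_iff_prob_eq_one (hF hS)).2 h)

lemma exists_ae_tendsto_const_of_asymptotically_invariant [IsProbabilityMeasure μ] {G : Type*}
    [AddGroup G] {τ : G → Ω → Ω} (hτ : IsMeasurePreservingAction τ μ)
    (hergodic : ∀ D, MeasurableSet D → (∀ g, τ g ⁻¹' D = D) → μ D = 0 ∨ μ D = 1)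
    {U : Set Ω} (hU : MeasurableSet U) (hμU : ∀ᵐ x ∂μ, x ∈ U) (hτU : ∀ g, ∀ x ∈ U, τ g x ∈ U)
    {A : ℕ → Ω → ℂ} (hA : ∀ n, Measurable (A n))
    (hlim : ∀ᵐ x ∂μ, ∃ c, Tendsto (fun n => A n x) atTop (𝓝 c))
    (hinv : ∀ g, ∀ x ∈ U, Tendsto (fun n => A n (τ g x) - A n x) atTop (𝓝 0)) :
    ∃ c, ∀ᵐ x ∂μ, Tendsto (fun n => A n x) atTop (𝓝 c) := by
  let F : Ω → ℂ := U.indicator fun x => limUnder atTop fun n => A n x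
  have hF : Measurable F :=
    (StronglyMeasurable.limUnder fun n => (hA n).stronglyMeasurable).measurable.indicator hU
  have hτF : ∀ g x, F (τ g x) = F x := by
    intro g x
    by_cases hx : x ∈ U
    · simp only [F, Set.indicator_of_mem hx, Set.indicator_of_mem (hτU g x hx)]
      refine limUnder_congr_of_tendsto_iff fun c => ⟨fun h => ?_, fun h => ?_⟩
      · simpa using h.sub (hinv g x hx)
      · simpa using h.add (hinv g x hx)
    · have hgx : τ g x ∉ U := fun h => hx (hτ.neg_apply_apply g x ▸ hτU (-g) _ h)
      simp only [F, Set.indicator_of_notMem hx, Set.indicator_of_notMem hgx]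
  obtain ⟨c, hc⟩ := exists_ae_eq_const_of_invariant hergodic hF hτF
  refine ⟨c, ?_⟩
  filter_upwards [hμU, hlim, hc] with x hx hxlim hxc
  simp only [F, Set.indicator_of_mem hx, Function.const_apply] at hxc
  exact hxc ▸ tendsto_nhds_limUnder hxlim

/-- The restriction of the action to the lattice need not be ergodic; asymptotic invariance under
`G` is what makes the limit constant. -/
theorem ae_tendsto_latticeAverage_of_ergodic [IsProbabilityMeasure μ] {G : Type*} [AddGroup G]
    {τ : G → Ω → Ω} (hτ : IsMeasurePreservingAction τ μ)
    (hergodic : ∀ D, MeasurableSet D → (∀ g, τ g ⁻¹' D = D) → μ D = 0 ∨ μ D = 1)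
    {U : Set Ω} (hU : MeasurableSet U) (hμU : ∀ᵐ x ∂μ, x ∈ U) (hτU : ∀ g, ∀ x ∈ U, τ g x ∈ U)
    {d : ℕ} (φ : (Fin d → ℤ) →+ G) {f : Ω → ℂ} (hf : Measurable f) {B : ℝ} (hB : ∀ x, ‖f x‖ ≤ B)
    (hinv : ∀ g, ∀ x ∈ U, Tendsto (fun n => latticeAverage (fun k => τ (φ k)) f n (τ g x) -
      latticeAverage (fun k => τ (φ k)) f n x) atTop (𝓝 0)) :
    ∀ᵐ x ∂μ, Tendsto (fun n => latticeAverage (fun k => τ (φ k)) f n x) atTop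
      (𝓝 (∫ x, f x ∂μ)) := by
  have hφ := hτ.comp φ
  have hA := stronglyMeasurable_latticeAverage hφ hf.stronglyMeasurable
  have hint : Integrable f μ :=
    .of_bound hf.aestronglyMeasurable B (Eventually.of_forall hB)
  obtain ⟨F, hF⟩ := exists_ae_tendsto_latticeAverage_complex hφ hf hB
  obtain ⟨c, hc⟩ := exists_ae_tendsto_const_of_asymptotically_invariant hτ hergodic hU hμU hτU
    (fun n => (hA n).measurable) (hF.mono fun x hx => ⟨F x, hx⟩) hinv
  have hlim : Tendsto (fun n => ∫ x, latticeAverage (fun k => τ (φ k)) f n x ∂μ) atTop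
      (𝓝 (∫ _, c ∂μ)) :=
    tendsto_integral_of_dominated_convergence (fun _ => B) (fun n => (hA n).aestronglyMeasurable)
      (integrable_const B) (fun n => Eventually.of_forall (norm_latticeAverage_le hB n)) hc
  have hconst : Tendsto (fun n => ∫ x, latticeAverage (fun k => τ (φ k)) f n x ∂μ) atTop
      (𝓝 (∫ x, f x ∂μ)) := by
    refine tendsto_const_nhds.congr' ?_
    filter_upwards [eventually_ne_atTop 0] with n hn using (integral_latticeAverage hφ hint hn).symm
  have hceq : ∫ x, f x ∂μ = c := by simpa using tendsto_nhds_unique hconst hlim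
  rwa [hceq]

end LatticeActions

section Boxes

variable {d : ℕ}

/-- The index of the half-open unit cell containing `x`. -/
def cellIndex (x : Pos d) : Fin d → ℤ := fun j => ⌊x j⌋

/-- The half-open box `[-N, N)^d`. -/
def box (d N : ℕ) : Set (Pos d) := {x | ∀ j, -(N : ℝ) ≤ x j ∧ x j < N}

lemma cellIndex_mem_latticeBox {N : ℕ} {x : Pos d} :
    cellIndex x ∈ latticeBox d N ↔ x ∈ box d N := by
  simp only [latticeBox, Fintype.mem_piFinset, Finset.mem_Ico, cellIndex, Int.le_floor,
    Int.floor_lt, Int.cast_neg, Int.cast_natCast]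
  exact Iff.rfl

lemma box_mono {N M : ℕ} (h : N ≤ M) : box d N ⊆ box d M := by
  intro x hx j
  have : (N : ℝ) ≤ M := Nat.cast_le.2 h
  exact ⟨by linarith [(hx j).1], by linarith [(hx j).2]⟩

lemma add_mem_box {N M : ℕ} {x y : Pos d} (hx : x ∈ box d N) (hy : y ∈ box d M) :
    x + y ∈ box d (N + M) := by
  intro j
  rw [PiLp.add_apply, Nat.cast_add]
  exact ⟨by linarith [(hx j).1, (hy j).1], by linarith [(hx j).2, (hy j).2]⟩

lemma neg_mem_box {N : ℕ} {x : Pos d} (hx : x ∈ box d N) : -x ∈ box d (N + 1) := by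
  intro j
  rw [PiLp.neg_apply, Nat.cast_add, Nat.cast_one]
  exact ⟨by linarith [(hx j).2], by linarith [(hx j).1]⟩

lemma exists_subset_box {s : Set (Pos d)} (hs : Bornology.IsBounded s) :
    ∃ N : ℕ, s ⊆ box d N := by
  obtain ⟨C, hC⟩ := hs.exists_norm_le
  obtain ⟨N, hN⟩ := exists_nat_gt C
  refine ⟨N, fun x hx j => ?_⟩
  have hxj := (PiLp.norm_apply_le x j).trans_lt ((hC x hx).trans_lt hN)
  rw [Real.norm_eq_abs, abs_lt] at hxj
  exact ⟨hxj.1.le, hxj.2⟩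

lemma exists_mem_box (x : Pos d) : ∃ N : ℕ, x ∈ box d N := by
  simpa using exists_subset_box (Bornology.isBounded_singleton (x := x))

/-- The indices within sup-distance `ρ` of `k`. -/
def nearCells (ρ : ℕ) (k : Fin d → ℤ) : Finset (Fin d → ℤ) :=
  Fintype.piFinset fun j => Finset.Ico (k j - ρ) (k j + ρ + 1)

lemma card_nearCells (ρ : ℕ) (k : Fin d → ℤ) : (nearCells ρ k).card = (2 * ρ + 1) ^ d := by
  rw [nearCells, Fintype.card_piFinset, Finset.prod_eq_pow_card fun j _ => ?_,
    Finset.card_fin]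
  rw [Int.card_Ico]
  omega

lemma cellIndex_mem_nearCells {ρ : ℕ} {x z : Pos d} (h : z - x ∈ box d ρ) :
    cellIndex z ∈ nearCells ρ (cellIndex x) := by
  simp only [nearCells, Fintype.mem_piFinset, Finset.mem_Ico, cellIndex]
  intro j
  have hj := h j
  rw [PiLp.sub_apply] at hj
  have hle := Int.floor_le (x j)
  have hlt := Int.lt_floor_add_one (x j)
  constructor
  · rw [Int.le_floor]; push_cast; linarith [hj.1]
  · rw [Int.floor_lt]; push_cast; linarith [hj.2]

end Boxes

section MultiSum

/-- The support of `G` is contained in the power of a box. -/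
def BoundedSupport {d : ℕ} {ι : Type*} (G : (ι → Pos d) → ℂ) : Prop :=
  ∃ L : ℕ, ∀ y, G y ≠ 0 → ∀ j, y j ∈ box d L

variable {d : ℕ} {ι κ : Type*} [Fintype ι] [Fintype κ]

/-- The sum of `G` over all `ι`-tuples, weighted by the product of the values of `W`. -/
def multiSum (W : Pos d → ℝ) (G : (ι → Pos d) → ℂ) : ℂ :=
  ∑ᶠ y : ι → Pos d, (∏ j, (W (y j) : ℂ)) * G y

lemma multiSum_eq_sum_of_subset {W : Pos d → ℝ} {G : (ι → Pos d) → ℂ} (Y : Finset (ι → Pos d))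
    (hY : ∀ y, G y ≠ 0 → (∀ j, W (y j) ≠ 0) → y ∈ Y) :
    multiSum W G = ∑ y ∈ Y, (∏ j, (W (y j) : ℂ)) * G y := by
  refine finsum_eq_sum_of_support_subset _ fun y hy => ?_
  rw [Function.mem_support, mul_ne_zero_iff, Finset.prod_ne_zero_iff] at hy
  exact hY y hy.2 fun j => Complex.ofReal_ne_zero.1 (hy.1 j (Finset.mem_univ j))

lemma multiSum_const_mul (W : Pos d → ℝ) (a : ℂ) (G : (ι → Pos d) → ℂ) :
    multiSum W (fun y => a * G y) = a * multiSum W G := by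
  rw [multiSum, multiSum, mul_finsum]
  exact finsum_congr fun y => mul_left_comm _ _ _

lemma multiSum_translate (W : Pos d → ℝ) (t : Pos d) (G : (ι → Pos d) → ℂ) :
    multiSum (fun x => W (x - t)) G = multiSum W (fun y => G fun j => y j + t) := by
  rw [multiSum, multiSum, ← finsum_comp_equiv (Equiv.addRight fun _ : ι => t)]
  exact finsum_congr fun y => by simp [Pi.add_def]

lemma multiSum_reindex (W : Pos d → ℝ) (e : κ ≃ ι) (G : (ι → Pos d) → ℂ) :
    multiSum W (fun y : κ → Pos d => G (y ∘ e.symm)) = multiSum W G := by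
  rw [multiSum, multiSum, ← finsum_comp_equiv (e.arrowCongr (Equiv.refl (Pos d)))]
  refine finsum_congr fun y => ?_
  congr 1
  exact Fintype.prod_equiv e _ _ fun j => by simp

/-- `W` is bounded by `c`, and has at most `K` points of its support in every unit cell. -/
structure Sparse (W : Pos d → ℝ) (c : ℝ) (K : ℕ) : Prop where
  abs_le : ∀ x, |W x| ≤ c
  encard_le : ∀ k, {x | W x ≠ 0 ∧ cellIndex x = k}.encard ≤ K

namespace Sparse

variable {W : Pos d → ℝ} {c : ℝ} {K : ℕ}

lemma const_nonneg (h : Sparse W c K) : 0 ≤ c := (abs_nonneg _).trans (h.abs_le 0)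

lemma finite_points (h : Sparse W c K) (Q : Finset (Fin d → ℤ)) :
    {x | W x ≠ 0 ∧ cellIndex x ∈ Q}.Finite := by
  have hcover : {x | W x ≠ 0 ∧ cellIndex x ∈ Q} =
      ⋃ k ∈ Q, {x | W x ≠ 0 ∧ cellIndex x = k} := by
    ext x; simp
  rw [hcover]
  exact Q.finite_toSet.biUnion fun k _ => Set.finite_of_encard_le_coe (h.encard_le k)

/-- The points of the support of `W` whose cell belongs to `Q`. -/
def points (h : Sparse W c K) (Q : Finset (Fin d → ℤ)) : Finset (Pos d) :=
  (h.finite_points Q).toFinset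

lemma mem_points (h : Sparse W c K) {Q : Finset (Fin d → ℤ)} {x : Pos d} :
    x ∈ h.points Q ↔ W x ≠ 0 ∧ cellIndex x ∈ Q :=
  (h.finite_points Q).mem_toFinset

lemma card_points_le (h : Sparse W c K) (Q : Finset (Fin d → ℤ)) :
    (h.points Q).card ≤ K * Q.card := by
  refine Finset.card_le_mul_card_image_of_maps_to (f := cellIndex)
    (fun x hx => (h.mem_points.1 hx).2) K fun k _ => ?_
  have hfiber : ((h.points Q).filter fun x => cellIndex x = k : Set (Pos d)).encard ≤ K := by
    refine le_trans (Set.encard_le_encard fun x hx => ?_) (h.encard_le k)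
    obtain ⟨hxQ, hxk⟩ := Finset.mem_filter.1 hx
    exact ⟨(h.mem_points.1 hxQ).1, hxk⟩
  rw [Set.encard_coe_eq_coe_finsetCard] at hfiber
  exact_mod_cast hfiber

lemma mem_piFinset_points [DecidableEq ι] (h : Sparse W c K) {L : ℕ} {y : ι → Pos d} :
    y ∈ Fintype.piFinset (fun _ => h.points (latticeBox d L)) ↔
      ∀ j, W (y j) ≠ 0 ∧ y j ∈ box d L := by
  simp only [Fintype.mem_piFinset, h.mem_points, cellIndex_mem_latticeBox]

lemma finite_support (h : Sparse W c K) {G : (ι → Pos d) → ℂ} (hG : BoundedSupport G) :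
    (fun y : ι → Pos d => (∏ j, (W (y j) : ℂ)) * G y).HasFiniteSupport := by
  classical
  obtain ⟨L, hL⟩ := hG
  refine (Finset.finite_toSet
    (Fintype.piFinset fun _ : ι => h.points (latticeBox d L))).subset fun y hy => ?_
  rw [Function.mem_support, mul_ne_zero_iff, Finset.prod_ne_zero_iff] at hy
  exact h.mem_piFinset_points.2 fun j =>
    ⟨Complex.ofReal_ne_zero.1 (hy.1 j (Finset.mem_univ j)), hL y hy.2 j⟩

lemma multiSum_add (h : Sparse W c K) {G G' : (ι → Pos d) → ℂ} (hG : BoundedSupport G)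
    (hG' : BoundedSupport G') :
    multiSum W (fun y => G y + G' y) = multiSum W G + multiSum W G' := by
  simp only [multiSum, mul_add, finsum_add_distrib (h.finite_support hG) (h.finite_support hG')]

lemma multiSum_sub (h : Sparse W c K) {G G' : (ι → Pos d) → ℂ} (hG : BoundedSupport G)
    (hG' : BoundedSupport G') :
    multiSum W (fun y => G y - G' y) = multiSum W G - multiSum W G' := by
  simp only [multiSum, mul_sub, finsum_sub_distrib (h.finite_support hG) (h.finite_support hG')]

lemma multiSum_sum (h : Sparse W c K) {α : Type*} (s : Finset α) {G : α → (ι → Pos d) → ℂ}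
    (hG : ∀ k, BoundedSupport (G k)) :
    multiSum W (fun y => ∑ k ∈ s, G k y) = ∑ k ∈ s, multiSum W (G k) := by
  simp only [multiSum, Finset.mul_sum]
  exact finsum_sum_comm _ _ fun k _ => h.finite_support (hG k)

lemma multiSum_mul (h : Sparse W c K) {G : (ι → Pos d) → ℂ} {G' : (κ → Pos d) → ℂ}
    (hG : BoundedSupport G) (hG' : BoundedSupport G') :
    multiSum W G * multiSum W G' =
      multiSum W (fun y : ι ⊕ κ → Pos d => G (y ∘ Sum.inl) * G' (y ∘ Sum.inr)) := by
  have hfinite : (fun p : (ι → Pos d) × (κ → Pos d) =>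
      (∏ j, (W (p.1 j) : ℂ)) * G p.1 * ((∏ j, (W (p.2 j) : ℂ)) * G' p.2)).HasFiniteSupport := by
    refine ((h.finite_support hG).prod (h.finite_support hG')).subset fun p hp => ?_
    exact mul_ne_zero_iff.1 hp
  simp only [multiSum, finsum_mul]
  simp only [mul_finsum]
  rw [← finsum_curry _ hfinite, ← finsum_comp_equiv (Equiv.sumArrowEquivProdArrow ι κ (Pos d))]
  refine finsum_congr fun y => ?_
  simp only [Fintype.prod_sum_type, Equiv.sumArrowEquivProdArrow, Equiv.coe_fn_mk,
    Function.comp_apply]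
  exact mul_mul_mul_comm _ _ _ _

lemma norm_prod_le (h : Sparse W c K) (y : ι → Pos d) :
    ‖∏ j, (W (y j) : ℂ)‖ ≤ c ^ Fintype.card ι := by
  rw [norm_prod, ← Finset.card_univ, ← Finset.prod_const]
  refine Finset.prod_le_prod (fun _ _ => norm_nonneg _) fun j _ => ?_
  rw [Complex.norm_real, Real.norm_eq_abs]
  exact h.abs_le _

lemma norm_multiSum_le_of_subset (h : Sparse W c K) {G : (ι → Pos d) → ℂ}
    (Y : Finset (ι → Pos d)) (hY : ∀ y, G y ≠ 0 → (∀ j, W (y j) ≠ 0) → y ∈ Y) {B : ℝ}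
    (hB : ∀ y, ‖G y‖ ≤ B) : ‖multiSum W G‖ ≤ Y.card * (c ^ Fintype.card ι * B) := by
  have hc := h.const_nonneg
  rw [multiSum_eq_sum_of_subset Y hY, ← nsmul_eq_mul, ← Finset.sum_const]
  refine norm_sum_le_of_le _ fun y _ => ?_
  rw [norm_mul]
  exact mul_le_mul (h.norm_prod_le y) (hB y) (norm_nonneg _) (by positivity)

lemma norm_multiSum_le (h : Sparse W c K) {G : (ι → Pos d) → ℂ} {L : ℕ}
    (hG : ∀ y, G y ≠ 0 → ∀ j, y j ∈ box d L) {B : ℝ} (hB : ∀ y, ‖G y‖ ≤ B) :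
    ‖multiSum W G‖ ≤
      ((K * (2 * L) ^ d : ℕ) : ℝ) ^ Fintype.card ι * (c ^ Fintype.card ι * B) := by
  classical
  have hB0 : 0 ≤ B := (norm_nonneg _).trans (hB fun _ => 0)
  have hc := h.const_nonneg
  refine (h.norm_multiSum_le_of_subset
    (Fintype.piFinset fun _ : ι => h.points (latticeBox d L)) (fun y hGy hWy =>
      h.mem_piFinset_points.2 fun j => ⟨hWy j, hG y hGy j⟩) hB).trans ?_
  rw [Fintype.card_piFinset, Finset.prod_const, Finset.card_univ, Nat.cast_pow, ← card_latticeBox]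
  gcongr
  exact h.card_points_le _

variable {n : ℕ}

/-- The `n + 1`-tuples of points of `W` whose first point lies in a cell of `Q` and whose other
points lie in cells at distance at most `ρ` from it. -/
def clusters (h : Sparse W c K) (n : ℕ) (Q : Finset (Fin d → ℤ)) (ρ : ℕ) :
    Finset (Fin (n + 1) → Pos d) :=
  open scoped Classical in
  (h.points Q).biUnion fun x =>
    (Fintype.piFinset fun _ : Fin n => h.points (nearCells ρ (cellIndex x))).image (Fin.cons x)

lemma mem_clusters (h : Sparse W c K) {Q : Finset (Fin d → ℤ)} {ρ : ℕ}
    {y : Fin (n + 1) → Pos d} (hW : ∀ j, W (y j) ≠ 0) (hQ : cellIndex (y 0) ∈ Q)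
    (hρ : ∀ j : Fin n, y j.succ - y 0 ∈ box d ρ) : y ∈ h.clusters n Q ρ := by
  classical
  refine Finset.mem_biUnion.2 ⟨y 0, h.mem_points.2 ⟨hW 0, hQ⟩,
    Finset.mem_image.2 ⟨Fin.tail y, ?_, Fin.cons_self_tail y⟩⟩
  exact Fintype.mem_piFinset.2 fun j =>
    h.mem_points.2 ⟨hW _, cellIndex_mem_nearCells (hρ j)⟩

lemma card_clusters_le (h : Sparse W c K) (n : ℕ) (Q : Finset (Fin d → ℤ)) (ρ : ℕ) :
    (h.clusters n Q ρ).card ≤ K * Q.card * (K * (2 * ρ + 1) ^ d) ^ n := by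
  classical
  refine (Finset.card_biUnion_le_card_mul _ _ ((K * (2 * ρ + 1) ^ d) ^ n) fun x _ => ?_).trans
    (Nat.mul_le_mul_right _ (h.card_points_le Q))
  refine Finset.card_image_le.trans ?_
  rw [Fintype.card_piFinset, Finset.prod_const, Finset.card_fin, ← card_nearCells ρ (cellIndex x)]
  exact Nat.pow_le_pow_left (h.card_points_le _) _

end Sparse

/-- The bound that sparsity puts, per cell, on a sum over clusters of `n + 1` points of diameter
`ρ`. -/
def clusterBound (d : ℕ) (c : ℝ) (K n ρ : ℕ) : ℝ :=
  K * (K * (2 * ρ + 1) ^ d) ^ n * c ^ (n + 1)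

lemma Sparse.norm_multiSum_le_card_mul {W : Pos d → ℝ} {c : ℝ} {K n : ℕ} (h : Sparse W c K)
    {E : (Fin (n + 1) → Pos d) → ℂ} (Q : Finset (Fin d → ℤ)) (ρ : ℕ)
    (hE : ∀ y, E y ≠ 0 → cellIndex (y 0) ∈ Q ∧ ∀ j : Fin n, y j.succ - y 0 ∈ box d ρ) {B : ℝ}
    (hB : ∀ y, ‖E y‖ ≤ B) : ‖multiSum W E‖ ≤ Q.card * (clusterBound d c K n ρ * B) := by
  have hB0 : 0 ≤ B := (norm_nonneg _).trans (hB fun _ => 0)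
  have hc := h.const_nonneg
  refine (h.norm_multiSum_le_of_subset (h.clusters n Q ρ) (fun y hEy hWy =>
    h.mem_clusters hWy (hE y hEy).1 (hE y hEy).2) hB).trans ?_
  rw [Fintype.card_fin]
  calc ((h.clusters n Q ρ).card : ℝ) * (c ^ (n + 1) * B)
      ≤ (K * Q.card * (K * (2 * ρ + 1) ^ d) ^ n : ℕ) * (c ^ (n + 1) * B) := by
        gcongr
        exact h.card_clusters_le n Q ρ
    _ = Q.card * (clusterBound d c K n ρ * B) := by
        rw [clusterBound]; push_cast; ring

end MultiSum

section Averages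

variable {d n : ℕ} {f : (Fin n → Pos d) → ℂ}

lemma tendsto_shell (d a : ℕ) : Tendsto (fun N : ℕ =>
    ((2 * (N : ℝ)) ^ d)⁻¹ * ((2 * ((N + a : ℕ) : ℝ)) ^ d - (2 * ((N - a : ℕ) : ℝ)) ^ d))
    atTop (𝓝 0) := by
  have hquot : Tendsto (fun N : ℕ => (a : ℝ) / N) atTop (𝓝 0) :=
    tendsto_const_div_atTop_nhds_zero_nat _
  have hlim := ((hquot.const_add 1).pow d).sub ((hquot.const_sub 1).pow d)
  rw [add_zero, sub_zero, sub_self] at hlim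
  refine hlim.congr' ?_
  filter_upwards [eventually_ge_atTop (a + 1)] with N hN
  have hN0 : (0 : ℝ) < N := Nat.cast_pos.2 (by omega)
  rw [inv_mul_eq_div, sub_div, ← div_pow, ← div_pow, Nat.cast_sub (by omega), Nat.cast_add]
  congr 2 <;> field_simp

/-- The function of a tuple `y ∈ A` that evaluates `f` at the differences from the first point. -/
def anchored (A : Set (Fin (n + 1) → Pos d)) (f : (Fin n → Pos d) → ℂ) :
    (Fin (n + 1) → Pos d) → ℂ :=
  A.indicator fun y => f fun j => y j.succ - y 0

open scoped Classical in
lemma anchored_apply (A : Set (Fin (n + 1) → Pos d)) (f : (Fin n → Pos d) → ℂ)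
    (y : Fin (n + 1) → Pos d) :
    anchored A f y = if y ∈ A then f (fun j => y j.succ - y 0) else 0 :=
  Set.indicator_apply _ _ _

lemma norm_anchored_le {B : ℝ} (hB : ∀ z, ‖f z‖ ≤ B) (A : Set (Fin (n + 1) → Pos d))
    (y : Fin (n + 1) → Pos d) : ‖anchored A f y‖ ≤ B :=
  (norm_indicator_le_norm_self _ _).trans (hB _)

lemma anchored_ne_zero {A : Set (Fin (n + 1) → Pos d)} {y : Fin (n + 1) → Pos d} :
    anchored A f y ≠ 0 ↔ y ∈ A ∧ f (fun j => y j.succ - y 0) ≠ 0 :=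
  Set.indicator_apply_ne_zero

lemma anchored_ne_anchored {A A' : Set (Fin (n + 1) → Pos d)} {y : Fin (n + 1) → Pos d}
    (h : anchored A f y ≠ anchored A' f y) :
    f (fun j => y j.succ - y 0) ≠ 0 ∧ ¬(y ∈ A ↔ y ∈ A') := by
  classical
  rw [anchored_apply, anchored_apply] at h
  exact ⟨fun h0 => h (by simp only [h0, ite_self]), fun hiff => h (if_congr hiff rfl rfl)⟩

lemma norm_anchored_sub_anchored_le {B : ℝ} (hB : ∀ z, ‖f z‖ ≤ B)
    (A A' : Set (Fin (n + 1) → Pos d)) (y : Fin (n + 1) → Pos d) :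
    ‖anchored A f y - anchored A' f y‖ ≤ B := by
  have hB0 : 0 ≤ B := (norm_nonneg _).trans (hB 0)
  by_cases hA : y ∈ A <;> by_cases hA' : y ∈ A' <;> simp [anchored_apply, hA, hA', hB, hB0]

lemma boundedSupport_anchored (hf : BoundedSupport f) {A : Set (Fin (n + 1) → Pos d)} {M : ℕ}
    (hA : ∀ y ∈ A, f (fun j => y j.succ - y 0) ≠ 0 → y 0 ∈ box d M) :
    BoundedSupport (anchored A f) := by
  obtain ⟨L, hL⟩ := hf
  refine ⟨M + L, fun y hy => ?_⟩
  obtain ⟨hyA, hfy⟩ := anchored_ne_zero.1 hy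
  have hy0 := hA y hyA hfy
  refine Fin.cases (box_mono (Nat.le_add_right M L) hy0) fun j => ?_
  simpa only [add_sub_cancel] using add_mem_box hy0 (hL _ hfy j)

/-- Among the tuples of diameter `ρ`, those in `A` are the ones that start in `[-N, N)^d`, up to an
error at distance `a` from the boundary of this box. -/
structure IsAlmostBox (N a ρ : ℕ) (A : Set (Fin (n + 1) → Pos d)) : Prop where
  mem_of_mem_box : ∀ y, (∀ j : Fin n, y j.succ - y 0 ∈ box d ρ) → y 0 ∈ box d (N - a) → y ∈ A
  mem_box_of_mem : ∀ y, (∀ j : Fin n, y j.succ - y 0 ∈ box d ρ) → y ∈ A → y 0 ∈ box d (N + a)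

lemma isAlmostBox_translate {N a : ℕ} {t : Pos d} (ht : t ∈ box d a) (ht' : -t ∈ box d a)
    (hN : a ≤ N) (ρ : ℕ) :
    IsAlmostBox N a ρ {y : Fin (n + 1) → Pos d | y 0 + t ∈ box d N} where
  mem_of_mem_box y _ hy := box_mono (by omega) (add_mem_box hy ht)
  mem_box_of_mem y _ hy := by simpa only [add_neg_cancel_right] using add_mem_box hy ht'

lemma cube_subset_box (d : ℕ) (R : ℝ) : cube d R ⊆ box d (⌊R / 2⌋₊ + 1) := by
  intro x hx j
  have hxj := abs_lt.1 (hx j)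
  have hfloor := Nat.lt_floor_add_one (R / 2)
  push_cast
  exact ⟨by linarith, by linarith⟩

lemma box_subset_cube (d : ℕ) {R : ℝ} (hR : 2 ≤ R) : box d (⌊R / 2⌋₊ - 1) ⊆ cube d R := by
  intro x hx j
  have hxj := hx j
  have hfloor := Nat.floor_le (show 0 ≤ R / 2 by linarith)
  rw [Nat.cast_sub (Nat.floor_pos.2 (by linarith)), Nat.cast_one] at hxj
  exact abs_lt.2 ⟨by linarith [hxj.1], by linarith [hxj.2]⟩

lemma isAlmostBox_cube {R : ℝ} {ρ : ℕ} (hR : 2 ≤ R) (hρ : ρ + 1 ≤ ⌊R / 2⌋₊) :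
    IsAlmostBox ⌊R / 2⌋₊ (ρ + 1) ρ {y : Fin (n + 1) → Pos d | ∀ j, y j ∈ cube d R} where
  mem_of_mem_box y hy hy0 := by
    refine Fin.cases (box_subset_cube d hR (box_mono (by omega) hy0)) fun j => ?_
    have hyj := add_mem_box hy0 (hy j)
    rw [add_sub_cancel] at hyj
    exact box_subset_cube d hR (box_mono (by omega) hyj)
  mem_box_of_mem y _ hy := box_mono (by omega) (cube_subset_box d R (hy 0))

/-- The average over the points `x ∈ [-N, N)^d` of the sums of `f (y₁ - x, …, yₙ - x)`. -/
def boxAverage (W : Pos d → ℝ) (f : (Fin n → Pos d) → ℂ) (N : ℕ) : ℂ :=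
  ((2 * N : ℝ) ^ d)⁻¹ • multiSum W (anchored {y | y 0 ∈ box d N} f)

namespace Sparse

variable {W : Pos d → ℝ} {c : ℝ} {K ρ : ℕ} {B : ℝ}

lemma norm_multiSum_anchored_sub_le (h : Sparse W c K)
    (hρ : ∀ z, f z ≠ 0 → ∀ j, z j ∈ box d ρ) (hB : ∀ z, ‖f z‖ ≤ B) {N a : ℕ}
    {A : Set (Fin (n + 1) → Pos d)} (hA : IsAlmostBox N a ρ A) :
    ‖multiSum W (anchored A f) - multiSum W (anchored {y | y 0 ∈ box d N} f)‖ ≤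
      ((2 * ((N + a : ℕ) : ℝ)) ^ d - (2 * ((N - a : ℕ) : ℝ)) ^ d) *
        (clusterBound d c K n ρ * B) := by
  have hsubset : latticeBox d (N - a) ⊆ latticeBox d (N + a) :=
    Fintype.piFinset_subset _ _ fun _ => Finset.Ico_subset_Ico (by omega) (by omega)
  have hsupport : BoundedSupport (anchored A f) :=
    boundedSupport_anchored ⟨ρ, hρ⟩ fun y hy hfy => hA.mem_box_of_mem y (hρ _ hfy) hy
  have hsupport' : BoundedSupport (anchored {y | y 0 ∈ box d N} f) :=
    boundedSupport_anchored ⟨ρ, hρ⟩ fun y hy _ => hy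
  rw [← h.multiSum_sub hsupport hsupport']
  refine (h.norm_multiSum_le_card_mul (latticeBox d (N + a) \ latticeBox d (N - a)) ρ
    (fun y hy => ?_) (norm_anchored_sub_anchored_le hB _ _)).trans_eq ?_
  · obtain ⟨hfy, hyN⟩ := anchored_ne_anchored (sub_ne_zero.1 hy)
    rw [Finset.mem_sdiff, cellIndex_mem_latticeBox, cellIndex_mem_latticeBox]
    refine ⟨⟨?_, fun hy' => hyN (iff_of_true (hA.mem_of_mem_box y (hρ _ hfy) hy') ?_)⟩, hρ _ hfy⟩
    · by_contra hy'
      exact hyN (iff_of_false (fun hyA => hy' (hA.mem_box_of_mem y (hρ _ hfy) hyA))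
        fun hy'' => hy' (box_mono (Nat.le_add_right N a) hy''))
    · exact box_mono (Nat.sub_le N a) hy'
  · rw [Finset.card_sdiff_of_subset hsubset, Nat.cast_sub (Finset.card_le_card hsubset),
      card_latticeBox, card_latticeBox]
    push_cast
    rfl

lemma tendsto_sub_boxAverage (h : Sparse W c K) (hρ : ∀ z, f z ≠ 0 → ∀ j, z j ∈ box d ρ)
    (hB : ∀ z, ‖f z‖ ≤ B) {α : Type*} {l : Filter α} {N : α → ℕ} (hN : Tendsto N l atTop)
    {a : ℕ} {A : α → Set (Fin (n + 1) → Pos d)} (hA : ∀ᶠ i in l, IsAlmostBox (N i) a ρ (A i)) :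
    Tendsto (fun i => ((2 * N i : ℝ) ^ d)⁻¹ • multiSum W (anchored (A i) f) -
      boxAverage W f (N i)) l (𝓝 0) := by
  have hshell := ((tendsto_shell d a).comp hN).mul_const (clusterBound d c K n ρ * B)
  rw [zero_mul] at hshell
  refine squeeze_zero_norm' ?_ hshell
  filter_upwards [hA] with i hi
  rw [boxAverage, ← smul_sub, norm_smul, norm_inv, norm_pow, norm_mul, Real.norm_two,
    Real.norm_natCast, Function.comp_apply, mul_assoc]
  gcongr
  exact h.norm_multiSum_anchored_sub_le hρ hB hi

lemma tendsto_boxAverage_translate_sub (h : Sparse W c K) (hf : BoundedSupport f)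
    (hB : ∀ z, ‖f z‖ ≤ B) (t : Pos d) :
    Tendsto (fun N => boxAverage (fun x => W (x - t)) f N - boxAverage W f N) atTop (𝓝 0) := by
  obtain ⟨ρ, hρ⟩ := hf
  obtain ⟨a, ha⟩ := exists_mem_box t
  have halmost : ∀ᶠ N in atTop,
      IsAlmostBox N (a + 1) ρ {y : Fin (n + 1) → Pos d | y 0 + t ∈ box d N} :=
    (eventually_ge_atTop (a + 1)).mono fun N hN =>
      isAlmostBox_translate (box_mono a.le_succ ha) (neg_mem_box ha) hN ρ
  refine (h.tendsto_sub_boxAverage hρ hB tendsto_id halmost).congr fun N => ?_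
  simp only [boxAverage, multiSum_translate, id_eq]
  congr! 4 with y
  simp only [anchored_apply, Set.mem_ofPred_eq, add_sub_add_right_eq_sub]

end Sparse

/-- The point of `ℝ^d` with the integer coordinates `k`. -/
def latticeVec : (Fin d → ℤ) →+ Pos d where
  toFun k := WithLp.toLp 2 fun j => (k j : ℝ)
  map_zero' := by ext j; simp
  map_add' k l := by ext j; simp

lemma cellIndex_sub_latticeVec (x : Pos d) (k : Fin d → ℤ) :
    cellIndex (x - latticeVec k) = cellIndex x - k := by
  ext j
  simp [cellIndex, latticeVec]

/-- The function `anchored A f` for the set `A` of the tuples that start in the cell `[0, 1)^d`. -/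
def cellAnchored (f : (Fin n → Pos d) → ℂ) : (Fin (n + 1) → Pos d) → ℂ :=
  anchored {y | cellIndex (y 0) = 0} f

lemma mem_box_one_of_cellIndex_eq_zero {x : Pos d} (hx : cellIndex x = 0) : x ∈ box d 1 := by
  rw [← cellIndex_mem_latticeBox, hx]
  simp [latticeBox]

lemma boundedSupport_cellAnchored (hf : BoundedSupport f) : BoundedSupport (cellAnchored f) :=
  boundedSupport_anchored hf fun _ hy _ => mem_box_one_of_cellIndex_eq_zero hy

lemma anchored_box_eq_sum (f : (Fin n → Pos d) → ℂ) (N : ℕ) (y : Fin (n + 1) → Pos d) :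
    anchored {y | y 0 ∈ box d N} f y =
      ∑ k ∈ latticeBox d N, cellAnchored f fun j => y j - latticeVec k := by
  simp only [cellAnchored, anchored_apply, Set.mem_ofPred_eq,
    cellIndex_sub_latticeVec, sub_eq_zero, sub_sub_sub_cancel_right, Finset.sum_ite_eq]
  classical
  exact if_congr cellIndex_mem_latticeBox.symm rfl rfl

lemma Sparse.boxAverage_eq {W : Pos d → ℝ} {c : ℝ} {K : ℕ} (h : Sparse W c K)
    (hf : BoundedSupport f) (N : ℕ) :
    boxAverage W f N = ((2 * N : ℝ) ^ d)⁻¹ • ∑ k ∈ latticeBox d N,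
      multiSum (fun x => W (x + latticeVec k)) (cellAnchored f) := by
  rw [boxAverage, funext (anchored_box_eq_sum f N), h.multiSum_sum]
  · simp only [sub_eq_add_neg, ← multiSum_translate, neg_neg]
  · intro k
    obtain ⟨L, hL⟩ := boundedSupport_cellAnchored hf
    obtain ⟨M, hM⟩ := exists_mem_box (latticeVec k)
    refine ⟨M + L, fun y hy j => ?_⟩
    simpa only [add_sub_cancel] using add_mem_box hM (hL _ hy j)

lemma volume_real_cube (d : ℕ) {R : ℝ} (hR : 0 ≤ R) : volume.real (cube d R) = R ^ d := by
  have hpre : cube d R = (WithLp.ofLp : Pos d → Fin d → ℝ) ⁻¹'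
      (Set.univ.pi fun _ => Set.Ioo (-(R / 2)) (R / 2)) := by
    ext x
    simp [cube, abs_lt]
  rw [measureReal_def, hpre, (PiLp.volume_preserving_ofLp (Fin d)).measure_preimage
    (MeasurableSet.univ_pi fun _ => measurableSet_Ioo).nullMeasurableSet, Real.volume_pi_Ioo]
  simp [ENNReal.toReal_ofReal hR]

lemma tendsto_two_mul_floor_half_div_pow (d : ℕ) :
    Tendsto (fun R : ℝ => (2 * (⌊R / 2⌋₊ : ℝ)) ^ d / R ^ d) atTop (𝓝 1) := by
  have hfloor : Tendsto (fun R : ℝ => (⌊R / 2⌋₊ : ℝ) / (R / 2)) atTop (𝓝 1) :=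
    (tendsto_nat_floor_div_atTop (R := ℝ)).comp (tendsto_id.atTop_div_const two_pos)
  have hpow := hfloor.pow d
  rw [one_pow] at hpow
  refine hpow.congr fun R => ?_
  rw [← div_pow, div_div_eq_mul_div, mul_comm]

namespace Sparse

variable {m : ℕ} {w : Fin m → ℝ} {lam : Measure (ColPt d m)} {c : ℝ} {K : ℕ} {B : ℝ}

lemma corrSum_eq_multiSum (h : Sparse (weightAt w lam) c K) (n : ℕ) (R : ℝ)
    (f : (Fin n → Pos d) → ℂ) :
    corrSum w lam n R f = multiSum (weightAt w lam) (anchored {y | ∀ j, y j ∈ cube d R} f) := by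
  have hsupport : BoundedSupport (anchored {y : Fin (n + 1) → Pos d | ∀ j, y j ∈ cube d R} f) :=
    ⟨_, fun y hy j => cube_subset_box d R ((anchored_ne_zero.1 hy).1 j)⟩
  rw [multiSum, ← finsum_comp_equiv (Fin.consEquiv fun _ => Pos d)]
  refine Eq.trans ?_ (finsum_curry _ ((h.finite_support hsupport).comp_of_injective
    (Fin.consEquiv fun _ => Pos d).injective)).symm
  rw [corrSum, finsum_mem_def]
  refine finsum_congr fun x => ?_
  simp only [finsum_mem_def]
  by_cases hx : x ∈ cube d R
  · rw [Set.indicator_of_mem hx]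
    refine finsum_congr fun y => ?_
    by_cases hy : ∀ j, y j ∈ cube d R <;>
      simp [anchored_apply, Fin.forall_fin_succ, Fin.prod_univ_succ, hx, hy]
  · simp [anchored_apply, Fin.forall_fin_succ, hx]

lemma tendsto_corrSum (h : Sparse (weightAt w lam) c K) (hf : BoundedSupport f)
    (hB : ∀ z, ‖f z‖ ≤ B) {l : ℂ} (hl : Tendsto (boxAverage (weightAt w lam) f) atTop (𝓝 l)) :
    Tendsto (fun R : ℝ => corrSum w lam n R f / ((volume.real (cube d R) : ℝ) : ℂ))
      atTop (𝓝 l) := by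
  obtain ⟨ρ, hρ⟩ := hf
  have hN : Tendsto (fun R : ℝ => ⌊R / 2⌋₊) atTop atTop :=
    tendsto_nat_floor_atTop.comp (tendsto_id.atTop_div_const two_pos)
  have halmost : ∀ᶠ R : ℝ in atTop, IsAlmostBox ⌊R / 2⌋₊ (ρ + 1) ρ
      {y : Fin (n + 1) → Pos d | ∀ j, y j ∈ cube d R} := by
    filter_upwards [hN.eventually_ge_atTop (ρ + 1), eventually_ge_atTop 2] with R hR hR2
    exact isAlmostBox_cube hR2 hR
  have hratio := (Complex.continuous_ofReal.tendsto 1).comp (tendsto_two_mul_floor_half_div_pow d)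
  have hlim := ((h.tendsto_sub_boxAverage hρ hB hN halmost).add (hl.comp hN)).mul hratio
  rw [zero_add, Complex.ofReal_one, mul_one] at hlim
  refine hlim.congr' ?_
  filter_upwards [hN.eventually_ge_atTop 1, eventually_gt_atTop 0] with R hR hR0
  have hN0 : (2 * (⌊R / 2⌋₊ : ℂ)) ^ d ≠ 0 :=
    pow_ne_zero _ (mul_ne_zero two_ne_zero (Nat.cast_ne_zero.2 (by omega)))
  rw [volume_real_cube d hR0.le, h.corrSum_eq_multiSum]
  simp only [Function.comp_apply, sub_add_cancel, Complex.real_smul]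
  push_cast
  field_simp

lemma norm_corrSum_div_le (h : Sparse (weightAt w lam) c K) {ρ : ℕ}
    (hρ : ∀ z, f z ≠ 0 → ∀ j, z j ∈ box d ρ) (hB : ∀ z, ‖f z‖ ≤ B) {R : ℝ} (hR : 2 ≤ R) :
    ‖corrSum w lam n R f / ((volume.real (cube d R) : ℝ) : ℂ)‖ ≤
      2 ^ d * clusterBound d c K n ρ * B := by
  have hB0 : 0 ≤ B := (norm_nonneg _).trans (hB 0)
  have hc := h.const_nonneg
  have hcluster : 0 ≤ clusterBound d c K n ρ := by rw [clusterBound]; positivity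
  have hcard : ((latticeBox d (⌊R / 2⌋₊ + 1)).card : ℝ) ≤ 2 ^ d * R ^ d := by
    have hfloor := Nat.floor_le (show 0 ≤ R / 2 by linarith)
    rw [card_latticeBox, Nat.cast_pow, ← mul_pow]
    gcongr
    push_cast
    linarith
  rw [volume_real_cube d (by linarith), norm_div, Complex.norm_real, Real.norm_eq_abs,
    abs_of_nonneg (by positivity), div_le_iff₀ (by positivity), h.corrSum_eq_multiSum]
  calc ‖multiSum (weightAt w lam) (anchored {y | ∀ j, y j ∈ cube d R} f)‖
      ≤ (latticeBox d (⌊R / 2⌋₊ + 1)).card * (clusterBound d c K n ρ * B) := by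
        refine h.norm_multiSum_le_card_mul _ ρ (fun y hy => ?_) (norm_anchored_le hB _)
        obtain ⟨hy, hfy⟩ := anchored_ne_zero.1 hy
        exact ⟨cellIndex_mem_latticeBox.2 (cube_subset_box d R (hy 0)), hρ _ hfy⟩
    _ ≤ 2 ^ d * R ^ d * (clusterBound d c K n ρ * B) := by gcongr
    _ = 2 ^ d * clusterBound d c K n ρ * B * R ^ d := by ring

end Sparse

end Averages

section NaturalValued

lemma exists_countable_piSystem (α : Type*) [MeasurableSpace α]
    [MeasurableSpace.CountablyGenerated α] :
    ∃ S : Set (Set α), S.Countable ∧ IsPiSystem S ∧ Set.univ ∈ S ∧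
      ‹MeasurableSpace α› = MeasurableSpace.generateFrom S := by
  classical
  set b := MeasurableSpace.countableGeneratingSet α
  have : Countable b := MeasurableSpace.countable_countableGeneratingSet
  refine ⟨Set.range fun F : Finset b => ⋂ s ∈ F, (s : Set α), Set.countable_range _, ?_,
    ⟨∅, by simp⟩, le_antisymm ?_ ?_⟩
  · rintro _ ⟨F, rfl⟩ _ ⟨F', rfl⟩ _
    exact ⟨F ∪ F', Finset.iInf_union⟩
  · conv_lhs => rw [← MeasurableSpace.generateFrom_countableGeneratingSet (α := α)]
    exact MeasurableSpace.generateFrom_mono fun s hs => ⟨{⟨s, hs⟩}, by simp⟩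
  · refine MeasurableSpace.generateFrom_le ?_
    rintro _ ⟨F, rfl⟩
    exact Finset.measurableSet_biInter _ fun s _ =>
      MeasurableSpace.measurableSet_countableGeneratingSet s.2

variable {α : Type*} [mα : MeasurableSpace α] {ν : Measure α}

lemma exists_nat_eq_measure_iUnion {f : ℕ → Set α} (hd : Pairwise (Function.onFun Disjoint f))
    (hm : ∀ n, MeasurableSet (f n)) (hfin : ν (⋃ n, f n) ≠ ⊤) (h : ∀ n, ∃ k : ℕ, ν (f n) = k) :
    ∃ k : ℕ, ν (⋃ n, f n) = k := by
  choose k hk using h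
  have hsum : Tendsto (fun n => ((∑ i ∈ Finset.range n, k i : ℕ) : ℝ)) atTop
      (𝓝 (ν.real (⋃ n, f n))) := by
    have htsum := ENNReal.tendsto_nat_tsum fun n => ν (f n)
    rw [← measure_iUnion hd hm] at htsum
    simpa [Function.comp_def, hk, ENNReal.toReal_sum, measureReal_def] using
      (ENNReal.tendsto_toReal hfin).comp htsum
  obtain ⟨l, hl⟩ := Nat.isClosedEmbedding_coe_real.isClosed_range.mem_of_tendsto hsum
    (Eventually.of_forall fun n => Set.mem_range_self _)
  exact ⟨l, by rw [← ofReal_measureReal hfin, ← hl, ENNReal.ofReal_natCast]⟩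

lemma exists_nat_eq_of_isPiSystem {S : Set (Set α)} (hS : IsPiSystem S)
    (hgen : mα = MeasurableSpace.generateFrom S) (huniv : Set.univ ∈ S)
    (h : ∀ A ∈ S, ∃ k : ℕ, ν A = k) {A : Set α} (hA : MeasurableSet A) : ∃ k : ℕ, ν A = k := by
  obtain ⟨l, hl⟩ := h _ huniv
  have hfin : IsFiniteMeasure ν := ⟨by rw [hl]; exact ENNReal.natCast_lt_top l⟩
  induction A, hA using MeasurableSpace.induction_on_inter hgen hS with
  | empty => exact ⟨0, by simp⟩
  | basic A hA => exact h A hA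
  | compl A hA ih =>
    obtain ⟨k, hk⟩ := ih
    exact ⟨l - k, by rw [measure_compl hA (measure_ne_top _ _), hk, hl]; simp⟩
  | iUnion f hd hm ih => exact exists_nat_eq_measure_iUnion hd hm (measure_ne_top _ _) ih

/-- Near a point of `A` that is not an atom the measure takes values `< 1`, hence vanishes. -/
lemma measure_eq_zero_of_forall_exists_nat [TopologicalSpace α] [SecondCountableTopology α]
    [T1Space α] [OpensMeasurableSpace α] {A : Set α} (hA : MeasurableSet A)
    (hnat : ∀ B ⊆ A, MeasurableSet B → ∃ k : ℕ, ν B = k) (hatom : ∀ p ∈ A, ν {p} = 0) :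
    ν A = 0 := by
  refine measure_null_of_locally_null A fun p hp => ?_
  obtain ⟨u, hu⟩ := (𝓝 p).exists_antitone_basis
  set v : ℕ → Set α := fun n => interior (u n) ∩ A
  have hvm : ∀ n, MeasurableSet (v n) := fun n => isOpen_interior.measurableSet.inter hA
  have hanti : Antitone v := fun a b hab =>
    Set.inter_subset_inter_left _ (interior_mono (hu.antitone hab))
  have hsingleton : ⋂ n, v n = {p} := by
    refine Set.Subset.antisymm (fun q hq => ?_) ?_
    · by_contra hne
      obtain ⟨n, hn⟩ := hu.mem_iff.1
        (isOpen_compl_singleton.mem_nhds (Ne.symm hne) : {q}ᶜ ∈ 𝓝 p)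
      exact hn (interior_subset (Set.mem_iInter.1 hq n).1) rfl
    · rintro _ rfl
      exact Set.mem_iInter.2 fun n => ⟨mem_interior_iff_mem_nhds.2 (hu.mem n), hp⟩
  have hnatv : ∀ n, ∃ k : ℕ, ν (v n) = k := fun n => hnat _ Set.inter_subset_right (hvm n)
  have hfin : ν (v 0) ≠ ⊤ := by
    obtain ⟨k, hk⟩ := hnatv 0
    exact hk ▸ ENNReal.natCast_ne_top k
  have hlim := tendsto_measure_iInter_atTop (fun n => (hvm n).nullMeasurableSet) hanti ⟨0, hfin⟩
  rw [hsingleton, hatom p hp] at hlim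
  obtain ⟨n, hn⟩ := (hlim.eventually_lt_const one_pos).exists
  refine ⟨v n, mem_nhdsWithin_iff_exists_mem_nhds_inter.2
    ⟨interior (u n), interior_mem_nhds.2 (hu.mem n), subset_rfl⟩, ?_⟩
  obtain ⟨k, hk⟩ := hnatv n
  rw [Function.comp_apply, hk] at hn
  rw [hk, Nat.lt_one_iff.1 (by exact_mod_cast hn : k < 1), Nat.cast_zero]

end NaturalValued

namespace ColouredPointProcess

section Shift

variable {d m : ℕ} {lam : Measure (ColPt d m)}

/-- Translation as a homeomorphism of the space of coloured points. -/
def shiftHomeomorph (t : Pos d) : ColPt d m ≃ₜ ColPt d m :=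
  (Homeomorph.addLeft t).prodCongr (Homeomorph.refl _)

lemma coe_shiftHomeomorph (t : Pos d) :
    ⇑(shiftHomeomorph t : ColPt d m ≃ₜ ColPt d m) = shift t := rfl

lemma measurable_shift (t : Pos d) : Measurable (shift t : ColPt d m → ColPt d m) :=
  (shiftHomeomorph t).measurable

lemma shiftMeasure_apply (t : Pos d) (lam : Measure (ColPt d m)) (A : Set (ColPt d m)) :
    shiftMeasure t lam A = lam (shift t ⁻¹' A) :=
  (shiftHomeomorph t).toMeasurableEquiv.map_apply A

lemma shiftMeasure_add (s t : Pos d) (lam : Measure (ColPt d m)) :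
    shiftMeasure (s + t) lam = shiftMeasure s (shiftMeasure t lam) := by
  ext A
  simp only [shiftMeasure_apply, ← Set.preimage_comp]
  congr 2
  ext p : 1
  simp [shift, add_assoc]

lemma shiftMeasure_zero (lam : Measure (ColPt d m)) : shiftMeasure 0 lam = lam := by
  ext A
  rw [shiftMeasure_apply]
  congr 1
  ext p
  simp [shift]

lemma weightAt_shiftMeasure (w : Fin m → ℝ) (t : Pos d) (lam : Measure (ColPt d m)) :
    weightAt w (shiftMeasure t lam) = fun x => weightAt w lam (x - t) := by
  ext x
  refine Finset.sum_congr rfl fun i _ => ?_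
  rw [measureReal_def, measureReal_def, shiftMeasure_apply]
  congr 3
  ext p
  simp [shift, Prod.ext_iff, eq_sub_iff_add_eq']

lemma IsPointMeasure.shiftMeasure (h : IsPointMeasure lam) (t : Pos d) :
    IsPointMeasure (shiftMeasure t lam) := by
  intro A hA hAc
  rw [shiftMeasure_apply]
  refine h _ (measurable_shift t hA) ?_
  rw [← coe_shiftHomeomorph, ← (shiftHomeomorph t).preimage_closure]
  exact (shiftHomeomorph t).isCompact_preimage.2 hAc

lemma shiftMeasure_mem_uniformlyDiscrete {r : ℝ} (h : lam ∈ uniformlyDiscrete d m r)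
    (t : Pos d) : shiftMeasure t lam ∈ uniformlyDiscrete d m r := by
  refine ⟨h.1.shiftMeasure t, fun a => ?_⟩
  rw [shiftMeasure_apply]
  refine le_of_eq_of_le (congrArg lam ?_) (h.2 (a - t))
  ext p
  rw [Set.mem_preimage, Set.mem_ofPred_eq, Set.mem_ofPred_eq, shift, sub_sub_eq_add_sub,
    add_comm p.1]

end Shift

section UniformlyDiscrete

variable {d m : ℕ}

lemma isOpen_cube (d : ℕ) (R : ℝ) : IsOpen (cube d R) := by
  rw [cube, Set.ofPred_forall]
  exact isOpen_iInter_of_finite fun k => isOpen_lt (by fun_prop) continuous_const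

lemma measurableSet_box (d N : ℕ) : MeasurableSet (box d N) := by
  rw [box, Set.ofPred_forall]
  refine MeasurableSet.iInter fun k => MeasurableSet.inter ?_ ?_
  · exact measurableSet_le measurable_const (by fun_prop : Measurable fun x : Pos d => x k)
  · exact measurableSet_lt (by fun_prop : Measurable fun x : Pos d => x k) measurable_const

lemma isBounded_box (d N : ℕ) : Bornology.IsBounded (box d N) := by
  refine isBounded_iff_forall_norm_le.2 ⟨√(∑ _k : Fin d, (N : ℝ) ^ 2), fun x hx => ?_⟩
  rw [EuclideanSpace.norm_eq]
  refine Real.sqrt_le_sqrt (Finset.sum_le_sum fun k _ => ?_)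
  exact pow_le_pow_left₀ (norm_nonneg _) (abs_le.2 ⟨(hx k).1, (hx k).2.le⟩) 2

/-- The coloured points with position in the box `[-N, N)^d`. -/
def colBox (d m N : ℕ) : Set (ColPt d m) := {p | p.1 ∈ box d N}

lemma measurableSet_colBox (d m N : ℕ) : MeasurableSet (colBox d m N) :=
  measurable_fst (measurableSet_box d N)

lemma isCompact_closure_of_subset_colBox {N : ℕ} {A : Set (ColPt d m)} (h : A ⊆ colBox d m N) :
    IsCompact (closure A) :=
  ((isBounded_box d N).isCompact_closure.prod isCompact_univ).closure_of_subset
    fun _ hp => ⟨subset_closure (h hp), Set.mem_univ _⟩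

lemma exists_subset_colBox {A : Set (ColPt d m)} (h : IsCompact (closure A)) :
    ∃ N, A ⊆ colBox d m N := by
  obtain ⟨N, hN⟩ := exists_subset_box ((h.image continuous_fst).isBounded.subset
    (Set.image_mono subset_closure))
  exact ⟨N, fun p hp => hN (Set.mem_image_of_mem _ hp)⟩

lemma isPointMeasure_iff_of_isPiSystem {S : Set (Set (ColPt d m))} (hS : IsPiSystem S)
    (hgen : Prod.instMeasurableSpace = MeasurableSpace.generateFrom S) (huniv : Set.univ ∈ S)
    {lam : Measure (ColPt d m)} :
    IsPointMeasure lam ↔ ∀ A ∈ S, ∀ N, ∃ k : ℕ, lam (A ∩ colBox d m N) = k := by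
  have hmeas : ∀ A ∈ S, MeasurableSet A := fun A hA =>
    hgen ▸ MeasurableSpace.measurableSet_generateFrom hA
  refine ⟨fun h A hA N => h _ ((hmeas A hA).inter (measurableSet_colBox d m N))
    (isCompact_closure_of_subset_colBox Set.inter_subset_right), fun h A hA hAc => ?_⟩
  obtain ⟨N, hN⟩ := exists_subset_colBox hAc
  rw [← Set.inter_eq_left.2 hN, ← Measure.restrict_apply hA]
  refine exists_nat_eq_of_isPiSystem hS hgen huniv (fun B hB => ?_) hA
  rw [Measure.restrict_apply (hmeas B hB)]
  exact h B hB N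

/-- The coloured points with position in the cube of edge length `R` about `a`. -/
def colCube (m : ℕ) {d : ℕ} (a : Pos d) (R : ℝ) : Set (ColPt d m) := {p | p.1 - a ∈ cube d R}

lemma measurableSet_colCube (a : Pos d) (R : ℝ) : MeasurableSet (colCube m a R) :=
  ((isOpen_cube d R).preimage
    (by fun_prop : Continuous fun p : ColPt d m => p.1 - a)).measurableSet

lemma colCube_mono (a : Pos d) : Monotone (colCube m a) :=
  fun _ _ h _ hp k => (hp k).trans_le (by linarith)

lemma colCube_subset_colCube {a b : Pos d} {R δ : ℝ} (h : dist a b < δ / 2) :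
    colCube m a (R - δ) ⊆ colCube m b R := by
  intro p hp k
  have hab : |(a - b) k| < δ / 2 := (PiLp.norm_apply_le (a - b) k).trans_lt (dist_eq_norm a b ▸ h)
  rw [← sub_add_sub_cancel p.1 a b, PiLp.add_apply]
  exact (abs_add_le _ _).trans_lt (by linarith [hp k])

lemma colCube_eq_iUnion (a : Pos d) (R : ℝ) :
    colCube m a R = ⋃ n : ℕ, colCube m a (R - 1 / ((n : ℝ) + 1)) := by
  refine Set.Subset.antisymm (fun p hp => Set.mem_iUnion.2 ?_)
    (Set.iUnion_subset fun n => colCube_mono a (sub_le_self _ (by positivity)))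
  have hlim : Tendsto (fun n : ℕ => (R - 1 / ((n : ℝ) + 1)) / 2) atTop (𝓝 (R / 2)) := by
    simpa using ((tendsto_one_div_add_atTop_nhds_zero_nat (𝕜 := ℝ)).const_sub R).div_const 2
  exact (eventually_all.2 fun j => hlim.eventually_const_lt (hp j)).exists

lemma forall_measure_colCube_le_one_iff {D : Set (Pos d)} (hD : Dense D) {r : ℝ}
    {lam : Measure (ColPt d m)} :
    (∀ a, lam (colCube m a r) ≤ 1) ↔ ∀ a ∈ D, lam (colCube m a r) ≤ 1 := by
  refine ⟨fun h a _ => h a, fun h a => ?_⟩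
  have hmono : Monotone fun n : ℕ => colCube m a (r - 1 / ((n : ℝ) + 1)) := fun n k hnk =>
    colCube_mono a (sub_le_sub_left (Nat.one_div_le_one_div hnk) r)
  rw [colCube_eq_iUnion, hmono.measure_iUnion]
  refine iSup_le fun n => ?_
  obtain ⟨b, hbD, hb⟩ := hD.exists_dist_lt a (show (0 : ℝ) < 1 / ((n : ℝ) + 1) / 2 by positivity)
  exact (measure_mono (colCube_subset_colCube hb)).trans (h b hbD)

theorem measurableSet_uniformlyDiscrete (d m : ℕ) (r : ℝ) :
    MeasurableSet (uniformlyDiscrete d m r) := by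
  obtain ⟨S, hScount, hSpi, hSuniv, hSgen⟩ := exists_countable_piSystem (ColPt d m)
  obtain ⟨D, hDcount, hDdense⟩ := TopologicalSpace.exists_countable_dense (Pos d)
  have hSmeas : ∀ A ∈ S, MeasurableSet A := fun A hA =>
    hSgen ▸ MeasurableSpace.measurableSet_generateFrom hA
  have hcount : uniformlyDiscrete d m r =
      (⋂ A ∈ S, ⋂ N, {lam | lam (A ∩ colBox d m N) ∈ Set.range ((↑) : ℕ → ENNReal)}) ∩
      ⋂ a ∈ D, {lam | lam (colCube m a r) ≤ 1} := by
    ext lam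
    simp only [Set.mem_inter_iff, Set.mem_iInter, Set.mem_ofPred_eq, Set.mem_range,
      ← forall_measure_colCube_le_one_iff hDdense, eq_comm (a := ((_ : ℕ) : ENNReal)),
      ← isPointMeasure_iff_of_isPiSystem hSpi hSgen hSuniv]
    exact Iff.rfl
  rw [hcount]
  refine MeasurableSet.inter
    (MeasurableSet.biInter hScount fun A hA => MeasurableSet.iInter fun N => ?_)
    (MeasurableSet.biInter hDcount fun a _ => ?_)
  · exact Measure.measurable_coe ((hSmeas A hA).inter (measurableSet_colBox d m N))
      (Set.countable_range _).measurableSet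
  · exact measurableSet_le (Measure.measurable_coe (measurableSet_colCube a r)) measurable_const

end UniformlyDiscrete

end ColouredPointProcess

namespace ColouredPointProcess

section Atoms

variable {d m : ℕ} {r : ℝ} {lam : Measure (ColPt d m)}

lemma mem_cube_zero (hr : 0 < r) : (0 : Pos d) ∈ cube d r := fun k => by simpa using hr

lemma IsPointMeasure.exists_nat_of_subset_colBox (h : IsPointMeasure lam) {N : ℕ}
    {A : Set (ColPt d m)} (hA : MeasurableSet A) (hAN : A ⊆ colBox d m N) :
    ∃ k : ℕ, lam A = k :=
  h A hA (isCompact_closure_of_subset_colBox hAN)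

lemma measure_singleton_eq_one (hl : lam ∈ uniformlyDiscrete d m r) (hr : 0 < r)
    {p : ColPt d m} (hp : lam {p} ≠ 0) : lam {p} = 1 := by
  obtain ⟨k, hk⟩ := hl.1 {p} (measurableSet_singleton p) (by simp)
  have hle : lam {p} ≤ 1 := (measure_mono (Set.singleton_subset_iff.2 <| by
    simpa using mem_cube_zero hr)).trans (hl.2 p.1)
  rw [hk] at hp hle
  have hk0 : k ≠ 0 := Nat.cast_ne_zero.1 hp
  have hk1 : k ≤ 1 := by exact_mod_cast hle
  rw [hk, show k = 1 by omega, Nat.cast_one]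

lemma eq_of_sub_mem_cube (hl : lam ∈ uniformlyDiscrete d m r) (hr : 0 < r) {p q : ColPt d m}
    (hp : lam {p} ≠ 0) (hq : lam {q} ≠ 0) (hpq : q.1 - p.1 ∈ cube d r) : p = q := by
  by_contra hne
  have hpair : lam {p, q} = 2 := by
    rw [← Set.singleton_union, measure_union (by simpa using hne) (measurableSet_singleton q),
      measure_singleton_eq_one hl hr hp, measure_singleton_eq_one hl hr hq, one_add_one_eq_two]
  have hsub : {p, q} ⊆ {x : ColPt d m | x.1 - p.1 ∈ cube d r} :=
    Set.pair_subset (by simpa using mem_cube_zero hr) hpq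
  have hle := (measure_mono hsub).trans (hl.2 p.1)
  rw [hpair] at hle
  norm_num at hle

lemma weightAt_of_atom (hl : lam ∈ uniformlyDiscrete d m r) (hr : 0 < r) (w : Fin m → ℝ)
    {x : Pos d} {i : Fin m} (h : lam {(x, i)} ≠ 0) : weightAt w lam x = w i := by
  rw [weightAt, Finset.sum_eq_single_of_mem i (Finset.mem_univ i) fun j _ hji => ?_]
  · simp [measureReal_def, measure_singleton_eq_one hl hr h]
  · have hzero : lam {(x, j)} = 0 := by
      by_contra hj
      have hpq := eq_of_sub_mem_cube hl hr h hj (by simpa using mem_cube_zero hr)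
      exact hji (congrArg Prod.snd hpq).symm
    simp [measureReal_def, hzero]

lemma weightAt_of_no_atom (w : Fin m → ℝ) {x : Pos d} (h : ∀ i, lam {(x, i)} = 0) :
    weightAt w lam x = 0 :=
  Finset.sum_eq_zero fun i _ => by simp [measureReal_def, h i]

lemma exists_atom_of_weightAt_ne_zero {w : Fin m → ℝ} {x : Pos d} (h : weightAt w lam x ≠ 0) :
    ∃ i, lam {(x, i)} ≠ 0 := by
  by_contra! hno
  exact h (weightAt_of_no_atom w hno)

lemma abs_weightAt_le (hl : lam ∈ uniformlyDiscrete d m r) (hr : 0 < r) (w : Fin m → ℝ)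
    (x : Pos d) : |weightAt w lam x| ≤ ∑ i, |w i| := by
  by_cases h : weightAt w lam x = 0
  · rw [h, abs_zero]
    exact Finset.sum_nonneg fun i _ => abs_nonneg _
  · obtain ⟨i, hi⟩ := exists_atom_of_weightAt_ne_zero h
    rw [weightAt_of_atom hl hr w hi]
    exact Finset.single_le_sum (fun j _ => abs_nonneg (w j)) (Finset.mem_univ i)

/-- A bound for the number of points of an `r`-uniformly discrete set in a unit cell. -/
def cellBound (d : ℕ) (r : ℝ) : ℕ := ⌈2 / r⌉₊ ^ d

/-- The cell is divided into cubes of edge length `1 / ⌈2 / r⌉ ≤ r / 2`, each of which contains at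
most one point. -/
lemma encard_cell_le_cellBound (hr : 0 < r) {S : Set (Pos d)} (k : Fin d → ℤ)
    (hk : ∀ x ∈ S, cellIndex x = k) (hS : ∀ x ∈ S, ∀ y ∈ S, y - x ∈ cube d r → x = y) :
    S.encard ≤ cellBound d r := by
  set M := ⌈2 / r⌉₊ with hM
  have hM0 : (0 : ℝ) < M := Nat.cast_pos.2 (Nat.ceil_pos.2 (by positivity))
  have hMr : 2 ≤ M * r := (div_le_iff₀ hr).1 (Nat.le_ceil (2 / r))
  set subcell : Pos d → Fin d → ℤ := fun x j => ⌊(M : ℝ) * x j⌋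
  have hinj : Set.InjOn subcell S := by
    intro x hx y hy hxy
    refine hS x hx y hy fun j => ?_
    have hlt := Int.abs_sub_lt_one_of_floor_eq_floor (congrFun hxy j).symm
    rw [← mul_sub, abs_mul, abs_of_pos hM0] at hlt
    rw [PiLp.sub_apply]
    nlinarith [abs_nonneg (y j - x j)]
  have hmaps : subcell '' S ⊆
      (Fintype.piFinset fun j => Finset.Ico (M * k j) (M * k j + M) : Finset (Fin d → ℤ)) := by
    rintro _ ⟨x, hx, rfl⟩
    rw [Finset.mem_coe, Fintype.mem_piFinset]
    intro j
    have hfloor : ⌊x j⌋ = k j := congrFun (hk x hx) j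
    have hle := Int.floor_le (x j)
    have hlt := Int.lt_floor_add_one (x j)
    rw [Finset.mem_Ico, ← hfloor, Int.le_floor, Int.floor_lt]
    push_cast
    constructor <;> nlinarith
  rw [← hinj.encard_image]
  refine (Set.encard_le_encard hmaps).trans_eq ?_
  rw [Set.encard_coe_eq_coe_finsetCard, Fintype.card_piFinset]
  simp [cellBound, hM]

theorem sparse_weightAt (hl : lam ∈ uniformlyDiscrete d m r) (hr : 0 < r) (w : Fin m → ℝ) :
    Sparse (weightAt w lam) (∑ i, |w i|) (cellBound d r) where
  abs_le := abs_weightAt_le hl hr w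
  encard_le k := by
    refine encard_cell_le_cellBound hr k (fun x hx => hx.2) fun x hx y hy hxy => ?_
    obtain ⟨i, hi⟩ := exists_atom_of_weightAt_ne_zero hx.1
    obtain ⟨j, hj⟩ := exists_atom_of_weightAt_ne_zero hy.1
    exact congrArg Prod.fst (eq_of_sub_mem_cube hl hr hi hj hxy)

/-- The all-ones weight makes every atom visible, so its points are the positions of the atoms. -/
lemma exists_finset_colBox (hl : lam ∈ uniformlyDiscrete d m r) (hr : 0 < r) (L : ℕ) :
    ∃ P : Finset (Pos d), P.card ≤ cellBound d r * (2 * L) ^ d ∧ (∀ x ∈ P, x ∈ box d L) ∧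
      ∀ x ∈ box d L, ∀ i, lam {(x, i)} ≠ 0 → x ∈ P := by
  have hsparse := sparse_weightAt hl hr fun _ => 1
  refine ⟨hsparse.points (latticeBox d L), ?_, fun x hx => ?_, fun x hx i hi => ?_⟩
  · rw [← card_latticeBox]
    exact hsparse.card_points_le _
  · exact cellIndex_mem_latticeBox.1 (hsparse.mem_points.1 hx).2
  · refine hsparse.mem_points.2 ⟨?_, cellIndex_mem_latticeBox.2 hx⟩
    rw [weightAt_of_atom hl hr _ hi]
    exact one_ne_zero

end Atoms

end ColouredPointProcess

section TupleKernel

open ProbabilityTheory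

variable {α β ι : Type*} [MeasurableSpace α] [MeasurableSpace β] [Fintype ι]

lemma measurable_measure_pi (κ : Kernel α β) [IsFiniteKernel κ] :
    Measurable fun a => Measure.pi fun _ : ι => κ a := by
  refine Measurable.measure_of_isPiSystem generateFrom_pi.symm isPiSystem_pi ?_ ?_
  · rintro _ ⟨s, hs, rfl⟩
    simp only [Measure.pi_pi]
    exact Finset.measurable_fun_prod _ fun j _ =>
      κ.measurable_coe (hs j (Set.mem_univ j))
  · simp only [Measure.pi_univ]
    exact Finset.measurable_fun_prod _ fun j _ => κ.measurable_coe MeasurableSet.univ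

/-- The kernel of independent `ι`-tuples drawn from the kernel `κ`. -/
def tupleKernel (κ : Kernel α β) [IsFiniteKernel κ] (ι : Type*) [Fintype ι] :
    Kernel α (ι → β) where
  toFun a := Measure.pi fun _ => κ a
  measurable' := measurable_measure_pi κ

instance isFiniteKernel_tupleKernel (κ : Kernel α β) [IsFiniteKernel κ] :
    IsFiniteKernel (tupleKernel κ ι) where
  exists_univ_le := by
    refine ⟨κ.bound ^ Fintype.card ι, ENNReal.pow_lt_top κ.bound_lt_top, fun a => ?_⟩
    rw [tupleKernel, Kernel.coe_mk, Measure.pi_univ, ← Finset.card_univ, ← Finset.prod_const]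
    exact Finset.prod_le_prod' fun _ _ => κ.measure_le_bound a Set.univ

lemma integral_pi_eq_sum [MeasurableSingletonClass β] {ν : Measure β} [IsFiniteMeasure ν]
    (P : Finset β) (hP : ν (P : Set β)ᶜ = 0) (g : (ι → β) → ℂ) :
    ∫ p, g p ∂Measure.pi (fun _ : ι => ν) =
      open scoped Classical in
      ∑ p ∈ Fintype.piFinset fun _ : ι => P, ((∏ j, ν.real {p j} : ℝ) : ℂ) * g p := by
  classical
  have hae : ∀ᵐ p ∂Measure.pi fun _ : ι => ν,
      p ∈ (Fintype.piFinset fun _ : ι => P : Set (ι → β)) := by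
    have hcoord : ∀ j, ∀ᵐ p ∂Measure.pi fun _ : ι => ν, p j ∈ (P : Set β) := fun j =>
      (Measure.tendsto_eval_ae_ae (μ := fun _ : ι => ν) (i := j)).eventually
        (measure_eq_zero_iff_ae_notMem.1 hP |>.mono fun p hp => not_not.1 hp)
    filter_upwards [ae_all_iff.2 hcoord] with p hp
    exact Finset.mem_coe.2 (Fintype.mem_piFinset.2 hp)
  rw [← Measure.restrict_eq_self_of_ae_mem hae, setIntegral_finset _ IntegrableOn.finset]
  refine Finset.sum_congr rfl fun p _ => ?_
  rw [measureReal_def, Measure.pi_singleton, ENNReal.toReal_prod, Complex.real_smul]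
  rfl

end TupleKernel

namespace ColouredPointProcess

open ProbabilityTheory

section Configurations

variable {d m : ℕ} {r : ℝ} {lam : Measure (ColPt d m)} {ι : Type*} [Fintype ι]

lemma restrict_colBox_compl_eq_zero (hl : lam ∈ uniformlyDiscrete d m r) {L : ℕ}
    {P : Finset (Pos d)} (hP : ∀ x ∈ box d L, ∀ i, lam {(x, i)} ≠ 0 → x ∈ P) :
    lam.restrict (colBox d m L) ((P ×ˢ Finset.univ : Finset (ColPt d m)) : Set _)ᶜ = 0 := by
  have hmeas : MeasurableSet ((P ×ˢ Finset.univ : Finset (ColPt d m)) : Set (ColPt d m))ᶜ :=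
    (Finset.measurableSet _).compl
  rw [Measure.restrict_apply hmeas]
  refine measure_eq_zero_of_forall_exists_nat (hmeas.inter (measurableSet_colBox d m L))
    (fun B hB hBm => hl.1.exists_nat_of_subset_colBox hBm (hB.trans Set.inter_subset_right)) ?_
  rintro ⟨x, i⟩ ⟨hnot, hx⟩
  by_contra hatom
  exact hnot (by simpa using hP x hx i hatom)

lemma measure_colBox_le (hl : lam ∈ uniformlyDiscrete d m r) (hr : 0 < r) (L : ℕ) :
    lam (colBox d m L) ≤ (cellBound d r * (2 * L) ^ d * m : ℕ) := by
  obtain ⟨P, hcard, -, hP⟩ := exists_finset_colBox hl hr L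
  set A : Finset (ColPt d m) := P ×ˢ Finset.univ
  have hatom : ∀ p, lam {p} ≤ 1 := fun p => by
    by_cases hp : lam {p} = 0
    · exact hp.trans_le zero_le_one
    · exact (measure_singleton_eq_one hl hr hp).le
  calc lam (colBox d m L) = lam.restrict (colBox d m L) Set.univ :=
        (Measure.restrict_apply_univ _).symm
    _ ≤ lam.restrict (colBox d m L) A + lam.restrict (colBox d m L) (A : Set _)ᶜ := by
        rw [← Set.union_compl_self (A : Set (ColPt d m))]
        exact measure_union_le _ _
    _ ≤ ∑ p ∈ A, lam {p} := by
        rw [restrict_colBox_compl_eq_zero hl hP, add_zero, sum_measure_singleton]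
        exact Measure.restrict_apply_le _ _
    _ ≤ A.card := by
        simpa using Finset.sum_le_sum fun p (_ : p ∈ A) => hatom p
    _ ≤ (cellBound d r * (2 * L) ^ d * m : ℕ) := by
        rw [Finset.card_product, Finset.card_univ, Fintype.card_fin]
        exact_mod_cast Nat.mul_le_mul_right m hcard

/-- The kernel that sends an `r`-uniformly discrete point measure to its restriction to a box. -/
def boxKernel (d m : ℕ) (r : ℝ) (L : ℕ) : Kernel (Measure (ColPt d m)) (ColPt d m) :=
  open scoped Classical in
  Kernel.piecewise (measurableSet_uniformlyDiscrete d m r)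
    (Kernel.restrict ⟨id, measurable_id⟩ (measurableSet_colBox d m L)) 0

lemma boxKernel_apply (hl : lam ∈ uniformlyDiscrete d m r) (L : ℕ) :
    boxKernel d m r L lam = lam.restrict (colBox d m L) := by
  classical
  rw [boxKernel, Kernel.piecewise_apply, if_pos hl, Kernel.restrict_apply]
  rfl

lemma isFiniteKernel_boxKernel (hr : 0 < r) (L : ℕ) : IsFiniteKernel (boxKernel d m r L) where
  exists_univ_le := by
    classical
    refine ⟨(cellBound d r * (2 * L) ^ d * m : ℕ), ENNReal.natCast_lt_top _, fun lam => ?_⟩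
    by_cases hl : lam ∈ uniformlyDiscrete d m r
    · rw [boxKernel_apply hl, Measure.restrict_apply_univ]
      exact measure_colBox_le hl hr L
    · rw [boxKernel, Kernel.piecewise_apply, if_neg hl]
      simp

lemma multiSum_weightAt_eq_integral (hl : lam ∈ uniformlyDiscrete d m r) (hr : 0 < r)
    (w : Fin m → ℝ) {L : ℕ} {G : (ι → Pos d) → ℂ} (hG : ∀ y, G y ≠ 0 → ∀ j, y j ∈ box d L) :
    multiSum (weightAt w lam) G = ∫ p : ι → ColPt d m,
      (∏ j, (w (p j).2 : ℂ)) * G (fun j => (p j).1)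
        ∂Measure.pi fun _ => lam.restrict (colBox d m L) := by
  classical
  obtain ⟨P, -, hPbox, hP⟩ := exists_finset_colBox hl hr L
  have hfin : IsFiniteMeasure (lam.restrict (colBox d m L)) :=
    isFiniteMeasure_restrict.2 ((measure_colBox_le hl hr L).trans_lt (ENNReal.natCast_lt_top _)).ne
  have hsubset : ∀ y, G y ≠ 0 → (∀ j, weightAt w lam (y j) ≠ 0) →
      y ∈ Fintype.piFinset fun _ : ι => P := fun y hGy hWy =>
    Fintype.mem_piFinset.2 fun j =>
      (exists_atom_of_weightAt_ne_zero (hWy j)).elim fun i hi => hP _ (hG y hGy j) i hi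
  rw [multiSum_eq_sum_of_subset _ hsubset,
    integral_pi_eq_sum _ (restrict_colBox_compl_eq_zero hl hP)]
  have hreal : ∀ p : ColPt d m, p.1 ∈ P →
      (lam.restrict (colBox d m L)).real {p} = lam.real {p} := fun p hp => by
    have hsub : {p} ⊆ colBox d m L := Set.singleton_subset_iff.2 (hPbox _ hp)
    rw [measureReal_restrict_apply (measurableSet_singleton p), Set.inter_eq_left.2 hsub]
  calc ∑ y ∈ Fintype.piFinset fun _ : ι => P, (∏ j, (weightAt w lam (y j) : ℂ)) * G y
      = ∑ y ∈ Fintype.piFinset fun _ : ι => P, ∑ c : ι → Fin m,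
          (∏ j, ((w (c j) * lam.real {(y j, c j)} : ℝ) : ℂ)) * G y := by
        refine Finset.sum_congr rfl fun y _ => ?_
        simp only [weightAt, Complex.ofReal_sum]
        rw [Fintype.prod_sum, Finset.sum_mul]
    _ = ∑ p ∈ Fintype.piFinset fun _ : ι => P ×ˢ (Finset.univ : Finset (Fin m)),
          ((∏ j, (lam.restrict (colBox d m L)).real {p j} : ℝ) : ℂ) *
            ((∏ j, (w (p j).2 : ℂ)) * G fun j => (p j).1) := by
        rw [← Finset.sum_product']
        refine Finset.sum_nbij' (fun q j => (q.1 j, q.2 j))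
          (fun p => (fun j => (p j).1, fun j => (p j).2)) (fun q hq => by simpa using hq)
          (fun p hp => by simpa using hp) (fun _ _ => rfl) (fun _ _ => rfl) fun q hq => ?_
        have hqP : ∀ j, q.1 j ∈ P := by simpa using hq
        rw [Finset.prod_congr rfl fun j _ => hreal (q.1 j, q.2 j) (hqP j)]
        simp only [Complex.ofReal_prod, Complex.ofReal_mul, Finset.prod_mul_distrib]
        ring

/-- Both variables are needed jointly because the parameter is later averaged over by Fubini. -/
theorem measurable_indicator_multiSum {T : Type*} [MeasurableSpace T] (hr : 0 < r)
    (w : Fin m → ℝ) {L : ℕ} {G : T → (ι → Pos d) → ℂ} (hG : Measurable (Function.uncurry G))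
    (hL : ∀ t y, G t y ≠ 0 → ∀ j, y j ∈ box d L) :
    Measurable fun q : T × Measure (ColPt d m) =>
      (uniformlyDiscrete d m r).indicator (fun lam => multiSum (weightAt w lam) (G q.1)) q.2 := by
  have hfin := isFiniteKernel_boxKernel (d := d) (m := m) hr L
  set κ : Kernel (T × Measure (ColPt d m)) (ι → ColPt d m) :=
    (tupleKernel (boxKernel d m r L) ι).comap Prod.snd measurable_snd
  have hint : Measurable fun q : T × Measure (ColPt d m) =>
      ∫ p, (∏ j, (w (p j).2 : ℂ)) * G q.1 (fun j => (p j).1) ∂κ q := by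
    refine (StronglyMeasurable.integral_kernel_prod_right' (κ := κ) (f := fun x =>
      (∏ j, (w (x.2 j).2 : ℂ)) * G x.1.1 fun j => (x.2 j).1) ?_).measurable
    refine Measurable.stronglyMeasurable (Measurable.mul ?_ ?_)
    · exact Finset.measurable_fun_prod _ fun j _ =>
        (measurable_of_countable fun i => (w i : ℂ)).comp (by fun_prop)
    · exact hG.comp (by fun_prop : Measurable fun x : (T × Measure (ColPt d m)) × (ι → ColPt d m) =>
        (x.1.1, fun j => (x.2 j).1))
  convert hint.indicator (measurable_snd (measurableSet_uniformlyDiscrete d m r)) using 1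
  ext q
  by_cases hq : q.2 ∈ uniformlyDiscrete d m r
  · rw [Set.indicator_of_mem hq, Set.indicator_of_mem (Set.mem_preimage.2 hq),
      multiSum_weightAt_eq_integral hq hr w (hL q.1)]
    simp only [κ, Kernel.comap_apply, tupleKernel, Kernel.coe_mk, boxKernel_apply hq]
  · rw [Set.indicator_of_notMem hq, Set.indicator_of_notMem (mt Set.mem_preimage.1 hq)]

end Configurations

end ColouredPointProcess

section Approximation

lemma tendsto_of_forall_exists_tendsto {α E : Type*} [SeminormedAddCommGroup E] {l : Filter α}
    {u : α → E} {a : E} (h : ∀ ε > 0, ∃ (v : α → E) (b : E), Tendsto v l (𝓝 b) ∧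
      (∀ᶠ i in l, ‖u i - v i‖ ≤ ε) ∧ ‖b - a‖ ≤ ε) : Tendsto u l (𝓝 a) := by
  refine Metric.tendsto_nhds.2 fun ε hε => ?_
  obtain ⟨v, b, hv, huv, hba⟩ := h (ε / 3) (by positivity)
  filter_upwards [huv, Metric.tendsto_nhds.1 hv (ε / 3) (by positivity)] with i hi hvi
  rw [← dist_eq_norm] at hi hba
  calc dist (u i) a ≤ dist (u i) (v i) + dist (v i) b + dist b a := dist_triangle4 _ _ _ _
    _ < ε := by linarith

lemma indicator_ae_eq_self {α β : Type*} [MeasurableSpace α] [Zero β] {ν : Measure α} {U : Set α}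
    (hU : ∀ᵐ x ∂ν, x ∈ U) (F : α → β) : U.indicator F =ᵐ[ν] F :=
  hU.mono fun _ hx => Set.indicator_of_mem hx F

end Approximation

section TestFunctions

variable {d n : ℕ} {ι : Type*}

/-- The class of functions whose sums over tuples of points are bounded random variables. -/
structure IsTestFunction (G : (ι → Pos d) → ℂ) : Prop where
  measurable : Measurable G
  exists_norm_le : ∃ B, ∀ y, ‖G y‖ ≤ B
  boundedSupport : BoundedSupport G

lemma BoundedSupport.hasCompactSupport {G : (ι → Pos d) → ℂ} (hG : BoundedSupport G) :
    HasCompactSupport G := by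
  obtain ⟨L, hL⟩ := hG
  refine HasCompactSupport.of_support_subset_isCompact
    (isCompact_univ_pi fun _ : ι => (isBounded_box d L).isCompact_closure) fun y hy j _ => ?_
  exact subset_closure (hL y hy j)

lemma exists_box_of_isCompact [Finite ι] {K : Set (ι → Pos d)} (hK : IsCompact K) :
    ∃ L : ℕ, ∀ y ∈ K, ∀ j, y j ∈ box d L := by
  have hunion : Bornology.IsBounded (⋃ j, (fun y : ι → Pos d => y j) '' K) :=
    Bornology.isBounded_iUnion.2 fun j => (hK.image (continuous_apply j)).isBounded
  obtain ⟨L, hL⟩ := exists_subset_box hunion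
  exact ⟨L, fun y hy j => hL (Set.mem_iUnion.2 ⟨j, y, hy, rfl⟩)⟩

lemma isTestFunction_coe [Finite ι] (f : C_c(ι → Pos d, ℂ)) : IsTestFunction f where
  measurable := by
    cases nonempty_fintype ι
    exact f.continuous.measurable
  exists_norm_le := f.hasCompactSupport.exists_bound_of_continuous f.continuous
  boundedSupport := by
    obtain ⟨L, hL⟩ := exists_box_of_isCompact f.hasCompactSupport.isCompact
    exact ⟨L, fun y hy => hL y (subset_tsupport _ hy)⟩

lemma measurable_cellIndex : Measurable (cellIndex : Pos d → Fin d → ℤ) :=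
  measurable_pi_lambda _ fun j => Int.measurable_floor.comp (by fun_prop)

lemma IsTestFunction.cellAnchored {f : (Fin n → Pos d) → ℂ} (hf : IsTestFunction f) :
    IsTestFunction (cellAnchored f) where
  measurable := (hf.measurable.comp (by fun_prop)).indicator
    (measurableSet_eq_fun (measurable_cellIndex.comp (measurable_pi_apply 0)) measurable_const)
  exists_norm_le := hf.exists_norm_le.imp fun _ hB => norm_anchored_le hB _
  boundedSupport := boundedSupport_cellAnchored hf.boundedSupport

end TestFunctions

section Separability

variable {X : Type*} [TopologicalSpace X] [T2Space X] [SecondCountableTopology X]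

lemma exists_countable_dense_of_isCompact {K : Set X} (hK : IsCompact K) :
    ∃ D : Set C_c(X, ℂ), D.Countable ∧ (∀ g ∈ D, Function.support g ⊆ K) ∧
      ∀ f : C_c(X, ℂ), Function.support f ⊆ K → ∀ ε > 0, ∃ g ∈ D, ∀ x, ‖f x - g x‖ ≤ ε := by
  have hcompact : CompactSpace K := isCompact_iff_compactSpace.1 hK
  let V := {f : C_c(X, ℂ) // Function.support f ⊆ K}
  let res : V → C(K, ℂ) := fun f => ⟨fun x => f.1 x, f.1.continuous.comp continuous_subtype_val⟩
  let _ : TopologicalSpace V := TopologicalSpace.induced res inferInstance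
  have hsecond : SecondCountableTopology V :=
    (Topology.IsInducing.induced res).secondCountableTopology
  obtain ⟨D, hDcountable, hDdense⟩ := TopologicalSpace.exists_countable_dense V
  refine ⟨Subtype.val '' D, hDcountable.image _, ?_, fun f hf ε hε => ?_⟩
  · rintro _ ⟨g, -, rfl⟩
    exact g.2
  obtain ⟨g, hgD, hg⟩ := hDdense.exists_mem_open
    (Metric.isOpen_ball.preimage continuous_induced_dom) ⟨⟨f, hf⟩, Metric.mem_ball_self hε⟩
  refine ⟨g.1, ⟨g, hgD, rfl⟩, fun x => ?_⟩
  by_cases hx : x ∈ K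
  · rw [← dist_eq_norm, dist_comm]
    exact (ContinuousMap.dist_apply_le_dist (f := res g) (g := res ⟨f, hf⟩) ⟨x, hx⟩).trans
      (le_of_lt hg)
  · rw [Function.notMem_support.1 (mt (@hf x) hx), Function.notMem_support.1 (mt (@g.2 x) hx)]
    simpa using hε.le

end Separability

namespace ColouredPointProcess

section Existence

variable {d m n : ℕ} {r : ℝ} {μ : Measure (Measure (ColPt d m))} {ι : Type*} [Fintype ι]
  {w : Fin m → ℝ}

lemma IsProcess.isMeasurePreservingAction (hμ : IsProcess μ) :
    IsMeasurePreservingAction shiftMeasure μ where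
  measurePreserving := hμ.stationary
  zero_apply := shiftMeasure_zero
  add_apply := shiftMeasure_add

lemma norm_indicator_multiSum_le (hr : 0 < r) (w : Fin m → ℝ) {G : (ι → Pos d) → ℂ} {L : ℕ}
    (hL : ∀ y, G y ≠ 0 → ∀ j, y j ∈ box d L) {B : ℝ} (hB : ∀ y, ‖G y‖ ≤ B)
    (lam : Measure (ColPt d m)) :
    ‖(uniformlyDiscrete d m r).indicator (fun lam => multiSum (weightAt w lam) G) lam‖ ≤
      ((cellBound d r * (2 * L) ^ d : ℕ) : ℝ) ^ Fintype.card ι *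
        ((∑ i, |w i|) ^ Fintype.card ι * B) := by
  by_cases hl : lam ∈ uniformlyDiscrete d m r
  · rw [Set.indicator_of_mem hl]
    exact (sparse_weightAt hl hr w).norm_multiSum_le hL hB
  · have hB0 : 0 ≤ B := (norm_nonneg _).trans (hB 0)
    rw [Set.indicator_of_notMem hl, norm_zero]
    positivity

lemma exists_norm_indicator_multiSum_le (hr : 0 < r) (w : Fin m → ℝ) {G : (ι → Pos d) → ℂ}
    (hG : IsTestFunction G) : ∃ B, ∀ lam, ‖(uniformlyDiscrete d m r).indicator
      (fun lam => multiSum (weightAt w lam) G) lam‖ ≤ B := by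
  obtain ⟨B, hB⟩ := hG.exists_norm_le
  obtain ⟨L, hL⟩ := hG.boundedSupport
  exact ⟨_, norm_indicator_multiSum_le hr w hL hB⟩

lemma measurable_indicator_multiSum_of_isTestFunction (hr : 0 < r) (w : Fin m → ℝ)
    {G : (ι → Pos d) → ℂ} (hG : IsTestFunction G) :
    Measurable ((uniformlyDiscrete d m r).indicator fun lam => multiSum (weightAt w lam) G) := by
  obtain ⟨L, hL⟩ := hG.boundedSupport
  exact (measurable_indicator_multiSum (G := fun _ : Unit => G) hr w
    (hG.measurable.comp measurable_snd) fun _ => hL).comp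
    (measurable_prodMk_left (x := ()))

lemma IsProcess.integrable_multiSum (hμ : IsProcess μ) (w : Fin m → ℝ) {G : (ι → Pos d) → ℂ}
    (hG : IsTestFunction G) : Integrable (fun lam => multiSum (weightAt w lam) G) μ := by
  have hprob := hμ.prob
  obtain ⟨r, hr, hU⟩ := hμ.unifDiscrete
  obtain ⟨B, hB⟩ := exists_norm_indicator_multiSum_le (m := m) hr w hG
  have hmeas := measurable_indicator_multiSum_of_isTestFunction (m := m) hr w hG
  exact (Integrable.of_bound hmeas.aestronglyMeasurable B (Eventually.of_forall hB)).congr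
    (indicator_ae_eq_self hU _)

lemma IsProcess.ae_tendsto_boxAverage (hμ : IsProcess μ) (w : Fin m → ℝ)
    {f : (Fin n → Pos d) → ℂ} (hf : IsTestFunction f) :
    ∀ᵐ lam ∂μ, Tendsto (boxAverage (weightAt w lam) f) atTop
      (𝓝 (∫ lam, multiSum (weightAt w lam) (cellAnchored f) ∂μ)) := by
  have hprob := hμ.prob
  obtain ⟨r, hr, hU⟩ := hμ.unifDiscrete
  set F := (uniformlyDiscrete d m r).indicator fun lam =>
    multiSum (weightAt w lam) (cellAnchored f) with hF
  obtain ⟨B, hB⟩ := exists_norm_indicator_multiSum_le (m := m) hr w hf.cellAnchored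
  obtain ⟨Bf, hBf⟩ := hf.exists_norm_le
  have haverage : ∀ lam ∈ uniformlyDiscrete d m r, ∀ N,
      latticeAverage (fun k => shiftMeasure ((-latticeVec) k)) F N lam =
        boxAverage (weightAt w lam) f N := by
    intro lam hl N
    rw [(sparse_weightAt hl hr w).boxAverage_eq hf.boundedSupport, latticeAverage]
    congr 1
    refine Finset.sum_congr rfl fun k _ => ?_
    rw [hF, Set.indicator_of_mem (shiftMeasure_mem_uniformlyDiscrete hl _), weightAt_shiftMeasure]
    simp only [AddMonoidHom.neg_apply, sub_neg_eq_add]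
  have hergodic := ae_tendsto_latticeAverage_of_ergodic hμ.isMeasurePreservingAction hμ.ergodic
    (measurableSet_uniformlyDiscrete d m r) hU
    (fun t _ hl => shiftMeasure_mem_uniformlyDiscrete hl t) (-latticeVec)
    (measurable_indicator_multiSum_of_isTestFunction hr w hf.cellAnchored) hB fun t lam hl => by
      simp only [F, haverage _ hl, haverage _ (shiftMeasure_mem_uniformlyDiscrete hl t),
        weightAt_shiftMeasure]
      exact (sparse_weightAt hl hr w).tendsto_boxAverage_translate_sub hf.boundedSupport hBf t
  rw [integral_congr_ae (indicator_ae_eq_self hU _)] at hergodic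
  filter_upwards [hergodic, hU] with lam hlam hl
  exact hlam.congr (haverage lam hl)

/-- The almost sure weighted `(n + 1)`-point correlation of the process `μ`. -/
def corrFunctional (hμ : IsProcess μ) (w : Fin m → ℝ) (n : ℕ) : C_c(Fin n → Pos d, ℂ) →ₗ[ℂ] ℂ where
  toFun f := ∫ lam, multiSum (weightAt w lam) (cellAnchored f) ∂μ
  map_add' f g := by
    obtain ⟨r, hr, hU⟩ := hμ.unifDiscrete
    have hf := (isTestFunction_coe f).cellAnchored
    have hg := (isTestFunction_coe g).cellAnchored
    rw [← integral_add (hμ.integrable_multiSum w hf) (hμ.integrable_multiSum w hg)]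
    refine integral_congr_ae (hU.mono fun lam hl => ?_)
    dsimp only
    rw [← (sparse_weightAt hl hr w).multiSum_add hf.boundedSupport hg.boundedSupport]
    congr 1
    exact Set.indicator_add _ _ _
  map_smul' a f := by
    rw [RingHom.id_apply, smul_eq_mul, ← integral_const_mul]
    refine integral_congr_ae (Eventually.of_forall fun lam => ?_)
    dsimp only
    rw [← multiSum_const_mul]
    congr 1
    exact Set.indicator_const_smul _ a _

lemma norm_corrFunctional_le (hμ : IsProcess μ) (hr : 0 < r)
    (hU : ∀ᵐ lam ∂μ, lam ∈ uniformlyDiscrete d m r) (w : Fin m → ℝ) {ρ : ℕ}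
    {f : C_c(Fin n → Pos d, ℂ)} (hρ : ∀ z, f z ≠ 0 → ∀ j, z j ∈ box d ρ) {B : ℝ}
    (hB : ∀ z, ‖f z‖ ≤ B) :
    ‖corrFunctional hμ w n f‖ ≤ clusterBound d (∑ i, |w i|) (cellBound d r) n ρ * B := by
  have hprob := hμ.prob
  refine (norm_integral_le_of_norm_le_const (hU.mono fun lam hl => ?_)).trans_eq
    (by rw [probReal_univ, mul_one])
  have hbound := (sparse_weightAt hl hr w).norm_multiSum_le_card_mul {0} ρ
    (E := cellAnchored f) (fun y hy => ?_) (norm_anchored_le hB _)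
  · simpa only [Finset.card_singleton, Nat.cast_one, one_mul] using hbound
  · obtain ⟨hy, hfy⟩ := anchored_ne_zero.1 hy
    exact ⟨Finset.mem_singleton.2 hy, hρ _ hfy⟩

lemma isRadonFunctional_corrFunctional (hμ : IsProcess μ) (w : Fin m → ℝ) (n : ℕ) :
    IsRadonFunctional (corrFunctional hμ w n) := by
  intro K hK
  obtain ⟨r, hr, hU⟩ := hμ.unifDiscrete
  obtain ⟨ρ, hρ⟩ := exists_box_of_isCompact hK
  exact ⟨_, fun f hf B hB => norm_corrFunctional_le hμ hr hU w
    (fun z hz => hρ z (hf (subset_tsupport _ hz))) hB⟩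

lemma corrSum_sub (hr : 0 < r) {lam : Measure (ColPt d m)} (hl : lam ∈ uniformlyDiscrete d m r)
    (w : Fin m → ℝ) (R : ℝ) (f g : (Fin n → Pos d) → ℂ) :
    corrSum w lam n R (f - g) = corrSum w lam n R f - corrSum w lam n R g := by
  have hs := sparse_weightAt hl hr w
  have hcube : ∀ f : (Fin n → Pos d) → ℂ, BoundedSupport (anchored {y | ∀ j, y j ∈ cube d R} f) :=
    fun f => ⟨_, fun y hy j => cube_subset_box d R ((anchored_ne_zero.1 hy).1 j)⟩
  simp only [hs.corrSum_eq_multiSum]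
  rw [← hs.multiSum_sub (hcube f) (hcube g)]
  congr 1
  exact Set.indicator_sub _ _ _

lemma tendsto_corrSum_of_dense (hμ : IsProcess μ) (hr : 0 < r)
    (hU : ∀ᵐ lam ∂μ, lam ∈ uniformlyDiscrete d m r) {lam : Measure (ColPt d m)}
    (hl : lam ∈ uniformlyDiscrete d m r) {K : Set (Fin n → Pos d)} (hK : IsCompact K)
    {D : Set C_c(Fin n → Pos d, ℂ)} (hDK : ∀ g ∈ D, Function.support g ⊆ K)
    (hD : ∀ g ∈ D, Tendsto (boxAverage (weightAt w lam) g) atTop (𝓝 (corrFunctional hμ w n g)))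
    {f : C_c(Fin n → Pos d, ℂ)} (hfK : Function.support f ⊆ K)
    (hfD : ∀ ε > 0, ∃ g ∈ D, ∀ z, ‖f z - g z‖ ≤ ε) :
    Tendsto (fun R : ℝ => corrSum w lam n R f / ((volume.real (cube d R) : ℝ) : ℂ)) atTop
      (𝓝 (corrFunctional hμ w n f)) := by
  have hs := sparse_weightAt hl hr w
  obtain ⟨ρ, hρ⟩ := exists_box_of_isCompact hK
  set C := clusterBound d (∑ i, |w i|) (cellBound d r) n ρ with hC
  have hC0 : 0 ≤ C := by rw [hC, clusterBound]; positivity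
  refine tendsto_of_forall_exists_tendsto fun ε hε => ?_
  have hδ : 0 < ε / (2 ^ d * C + 1) := by positivity
  have hsmall : 2 ^ d * C * (ε / (2 ^ d * C + 1)) ≤ ε := by
    rw [mul_div_assoc', div_le_iff₀ (by positivity)]
    nlinarith
  obtain ⟨g, hgD, hfg⟩ := hfD _ hδ
  have hsupport : ∀ z, (f - g) z ≠ 0 → ∀ j, z j ∈ box d ρ := fun z hz => hρ z <|
    Function.support_sub f g |>.trans (Set.union_subset hfK (hDK g hgD)) hz
  obtain ⟨B, hB⟩ := (isTestFunction_coe g).exists_norm_le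
  refine ⟨_, _, hs.tendsto_corrSum (isTestFunction_coe g).boundedSupport hB (hD g hgD), ?_, ?_⟩
  · filter_upwards [eventually_ge_atTop 2] with R hR
    rw [← sub_div, ← corrSum_sub hr hl]
    exact (hs.norm_corrSum_div_le hsupport hfg hR).trans hsmall
  · rw [norm_sub_rev, ← map_sub]
    refine (norm_corrFunctional_le hμ hr hU w hsupport hfg).trans (le_trans ?_ hsmall)
    gcongr
    exact le_mul_of_one_le_left hC0 (one_le_pow₀ one_le_two)

theorem IsProcess.ae_isCorrelation (hμ : IsProcess μ) (w : Fin m → ℝ) (n : ℕ) :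
    ∀ᵐ lam ∂μ, IsCorrelation w lam n (corrFunctional hμ w n) := by
  obtain ⟨r, hr, hU⟩ := hμ.unifDiscrete
  let K : CompactExhaustion (Fin n → Pos d) := default
  choose D hDcountable hDK hD using fun k => exists_countable_dense_of_isCompact (K.isCompact k)
  have hdense : ∀ᵐ lam ∂μ, ∀ k, ∀ g ∈ D k, Tendsto (boxAverage (weightAt w lam) g) atTop
      (𝓝 (corrFunctional hμ w n g)) :=
    ae_all_iff.2 fun k => (ae_ball_iff (hDcountable k)).2 fun g _ =>
      hμ.ae_tendsto_boxAverage w (isTestFunction_coe g)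
  filter_upwards [hdense, hU] with lam hdense hl
  refine ⟨isRadonFunctional_corrFunctional hμ w n, fun f => ?_⟩
  obtain ⟨k, hk⟩ := K.exists_superset_of_isCompact f.hasCompactSupport.isCompact
  have hfK := (subset_tsupport f).trans hk
  exact tendsto_corrSum_of_dense hμ hr hU hl (K.isCompact k) (hDK k) (hdense k) hfK (hD k f hfK)

end Existence

end ColouredPointProcess

section UnitCell

variable {d : ℕ}

/-- The indicator function of the unit cell `[0, 1)^d`. -/
def cellIndicator : Pos d → ℂ := {x | cellIndex x = 0}.indicator 1

lemma measurableSet_unitCell (d : ℕ) : MeasurableSet {x : Pos d | cellIndex x = 0} :=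
  measurableSet_eq_fun measurable_cellIndex measurable_const

@[fun_prop]
lemma measurable_cellIndicator : Measurable (cellIndicator : Pos d → ℂ) :=
  measurable_one.indicator (measurableSet_unitCell d)

lemma norm_cellIndicator_mul_le (x : Pos d) (a : ℂ) : ‖cellIndicator x * a‖ ≤ ‖a‖ := by
  rw [norm_mul]
  exact mul_le_of_le_one_left (norm_nonneg a) ((norm_indicator_le_norm_self _ _).trans_eq norm_one)

lemma mem_box_one_of_cellIndicator_ne_zero {x : Pos d} (hx : cellIndicator x ≠ 0) : x ∈ box d 1 :=
  mem_box_one_of_cellIndex_eq_zero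
    (Set.mem_of_indicator_ne_zero (s := {x | cellIndex x = 0}) hx)

lemma integral_cellIndicator (d : ℕ) : ∫ x : Pos d, cellIndicator x = 1 := by
  have hpre : {x : Pos d | cellIndex x = 0} = (WithLp.ofLp : Pos d → Fin d → ℝ) ⁻¹'
      Set.univ.pi fun _ => Set.Ico 0 1 := by
    ext x
    simp [cellIndex, funext_iff, Int.floor_eq_zero_iff]
  have hvolume : volume {x : Pos d | cellIndex x = 0} = 1 := by
    rw [hpre, (PiLp.volume_preserving_ofLp (Fin d)).measure_preimage
      (MeasurableSet.univ_pi fun _ => measurableSet_Ico).nullMeasurableSet, volume_pi_pi]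
    simp
  rw [cellIndicator, integral_indicator (measurableSet_unitCell d)]
  simp [measureReal_def, hvolume]

lemma cellAnchored_apply {n : ℕ} (f : (Fin n → Pos d) → ℂ) (y : Fin (n + 1) → Pos d) :
    cellAnchored f y = cellIndicator (y 0) * f fun j => y j.succ - y 0 := by
  by_cases hy : cellIndex (y 0) = 0 <;> simp [cellAnchored, anchored, cellIndicator, hy]

end UnitCell

section Reduction

variable {d n : ℕ}

/-- The integral of `G` over the translates of an `(n + 1)`-tuple, as a function of the differences
`z` to its first entry. -/
def reduceFun (G : (Fin (n + 1) → Pos d) → ℂ) (z : Fin n → Pos d) : ℂ :=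
  ∫ s : Pos d, G (Fin.cons s fun j => z j + s)

lemma continuous_reduceFun {G : (Fin (n + 1) → Pos d) → ℂ} (hGc : Continuous G)
    (hG : BoundedSupport G) : Continuous (reduceFun G) := by
  obtain ⟨L, hL⟩ := hG
  have hcont : Continuous (Function.uncurry fun (z : Fin n → Pos d) (s : Pos d) =>
      G (Fin.cons s fun j => z j + s)) := by
    refine hGc.comp (continuous_pi (Fin.cases ?_ fun j => ?_))
    · exact continuous_snd
    · simp only [Fin.cons_succ]; fun_prop
  have hint := continuous_parametric_integral_of_continuous (μ := (volume : Measure (Pos d))) hcont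
    (isBounded_box d L).isCompact_closure
  refine hint.congr fun z => setIntegral_eq_integral_of_forall_compl_eq_zero fun s hs => ?_
  contrapose! hs
  exact subset_closure (hL _ hs 0)

lemma boundedSupport_reduceFun {G : (Fin (n + 1) → Pos d) → ℂ} (hG : BoundedSupport G) :
    BoundedSupport (reduceFun G) := by
  obtain ⟨L, hL⟩ := hG
  refine ⟨L + (L + 1), fun z hz j => ?_⟩
  obtain ⟨s, hs⟩ := exists_ne_zero_of_integral_ne_zero hz
  simpa using add_mem_box (hL _ hs j.succ) (neg_mem_box (hL _ hs 0))

/-- `reduceFun` as a map between spaces of compactly supported functions. -/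
def reduceMap (G : C_c(Fin (n + 1) → Pos d, ℂ)) : C_c(Fin n → Pos d, ℂ) where
  toFun := reduceFun G
  continuous_toFun := continuous_reduceFun G.continuous (isTestFunction_coe G).boundedSupport
  hasCompactSupport' :=
    (boundedSupport_reduceFun (isTestFunction_coe G).boundedSupport).hasCompactSupport

lemma cellAnchored_reduceFun (G : (Fin (n + 1) → Pos d) → ℂ) (y : Fin (n + 1) → Pos d) :
    cellAnchored (reduceFun G) y = ∫ t, cellIndicator (y 0) * G fun j => y j + t := by
  rw [integral_const_mul, cellAnchored_apply, reduceFun,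
    ← integral_add_left_eq_self (μ := volume) _ (y 0)]
  congr 2 with t
  congr 1
  refine funext (Fin.cases rfl fun j => ?_)
  rw [Fin.cons_succ]
  abel

end Reduction

namespace ColouredPointProcess

section Moments

variable {d m n : ℕ} {r : ℝ} {μ : Measure (Measure (ColPt d m))} {ι : Type*} [Fintype ι]
  {T : Type*} [MeasurableSpace T] {ν : Measure T} {S : Set T} {H : T → (ι → Pos d) → ℂ} {L : ℕ}
  {B : ℝ}

lemma multiSum_integral {W : Pos d → ℝ} {c : ℝ} {K : ℕ} (h : Sparse W c K)
    (hL : ∀ t y, H t y ≠ 0 → ∀ j, y j ∈ box d L) (hint : ∀ y, Integrable (fun t => H t y) ν) :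
    multiSum W (fun y => ∫ t, H t y ∂ν) = ∫ t, multiSum W (H t) ∂ν := by
  classical
  have hsum : ∀ G : (ι → Pos d) → ℂ, (∀ y, G y ≠ 0 → ∀ j, y j ∈ box d L) → multiSum W G =
      ∑ y ∈ Fintype.piFinset fun _ : ι => h.points (latticeBox d L),
        (∏ j, (W (y j) : ℂ)) * G y := fun G hG =>
    multiSum_eq_sum_of_subset _ fun y hy hW =>
      h.mem_piFinset_points.2 fun j => ⟨hW j, hG y hy j⟩
  rw [hsum _ fun y hy => (exists_ne_zero_of_integral_ne_zero hy).elim fun t ht => hL t y ht]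
  simp only [hsum _ (hL _)]
  rw [integral_finsetSum _ fun y _ => (hint y).const_mul _]
  simp only [integral_const_mul]

lemma IsProcess.integral_multiSum_swap [SFinite ν] (hμ : IsProcess μ) (w : Fin m → ℝ)
    (hH : Measurable (Function.uncurry H)) (hB : ∀ t y, ‖H t y‖ ≤ B)
    (hνS : ν S ≠ ⊤) (hHS : ∀ t y, H t y ≠ 0 → t ∈ S)
    (hL : ∀ t y, H t y ≠ 0 → ∀ j, y j ∈ box d L) :
    ∫ t, ∫ lam, multiSum (weightAt w lam) (H t) ∂μ ∂ν =
      ∫ lam, multiSum (weightAt w lam) (fun y => ∫ t, H t y ∂ν) ∂μ := by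
  have hprob := hμ.prob
  obtain ⟨r, hr, hU⟩ := hμ.unifDiscrete
  set Ψ : T → Measure (ColPt d m) → ℂ := fun t =>
    (uniformlyDiscrete d m r).indicator fun lam => multiSum (weightAt w lam) (H t) with hΨ
  have hΨint : Integrable (Function.uncurry Ψ) (ν.prod μ) := by
    have hbound := Measure.integrableOn_of_bounded (μ := ν.prod μ) (s := S ×ˢ Set.univ)
      (by simpa using hνS) (measurable_indicator_multiSum hr w hH hL).aestronglyMeasurable
      (Eventually.of_forall fun q => norm_indicator_multiSum_le hr w (hL q.1) (hB q.1) q.2)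
    refine hbound.integrable_of_forall_notMem_eq_zero fun q hq => ?_
    have hHq : ∀ y, H q.1 y = 0 := fun y => not_not.1 fun hy => hq ⟨hHS _ y hy, trivial⟩
    simp [multiSum, hHq]
  have hHint : ∀ y, Integrable (fun t => H t y) ν := fun y =>
    (Measure.integrableOn_of_bounded hνS
      (hH.comp (measurable_prodMk_right (y := y))).aestronglyMeasurable
      (Eventually.of_forall fun t => hB t y)).integrable_of_forall_notMem_eq_zero
        fun t ht => not_not.1 fun hy => ht (hHS t y hy)
  calc ∫ t, ∫ lam, multiSum (weightAt w lam) (H t) ∂μ ∂ν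
      = ∫ t, ∫ lam, Ψ t lam ∂μ ∂ν := by
        simp only [hΨ, integral_congr_ae (indicator_ae_eq_self hU _)]
    _ = ∫ lam, ∫ t, Ψ t lam ∂ν ∂μ := integral_integral_swap hΨint
    _ = ∫ lam, multiSum (weightAt w lam) (fun y => ∫ t, H t y ∂ν) ∂μ := by
        refine integral_congr_ae (hU.mono fun lam hl => ?_)
        simp only [hΨ, Set.indicator_of_mem hl]
        exact (multiSum_integral (sparse_weightAt hl hr w) hL hHint).symm

lemma IsProcess.integral_shiftMeasure (hμ : IsProcess μ) (t : Pos d)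
    {Φ : Measure (ColPt d m) → ℂ} (hΦ : AEStronglyMeasurable Φ μ) :
    ∫ lam, Φ (shiftMeasure t lam) ∂μ = ∫ lam, Φ lam ∂μ := by
  have h := hμ.stationary t
  rw [← integral_map h.measurable.aemeasurable (by rwa [h.map_eq]), h.map_eq]

lemma IsProcess.integral_multiSum_translate (hμ : IsProcess μ) (w : Fin m → ℝ)
    {G : (ι → Pos d) → ℂ} (hG : IsTestFunction G) (t : Pos d) :
    ∫ lam, multiSum (weightAt w lam) (fun y => G fun j => y j + t) ∂μ =
      ∫ lam, multiSum (weightAt w lam) G ∂μ := by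
  rw [← hμ.integral_shiftMeasure t (hμ.integrable_multiSum w hG).aestronglyMeasurable]
  simp only [weightAt_shiftMeasure, multiSum_translate]

lemma mem_box_of_cellIndicator_sub_mul_ne_zero {G : (Fin (n + 1) → Pos d) → ℂ}
    (hL : ∀ y, G y ≠ 0 → ∀ j, y j ∈ box d L) {t : Pos d} {y : Fin (n + 1) → Pos d}
    (hy : cellIndicator (y 0 - t) * G y ≠ 0) : t ∈ box d (L + 2) := by
  obtain ⟨hcell, hGy⟩ := mul_ne_zero_iff.1 hy
  simpa using add_mem_box (hL _ hGy 0) (neg_mem_box (mem_box_one_of_cellIndicator_ne_zero hcell))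

lemma IsProcess.integral_multiSum_cellIndicator_sub_mul (hμ : IsProcess μ) (w : Fin m → ℝ)
    {G : (Fin (n + 1) → Pos d) → ℂ} (hG : IsTestFunction G) :
    ∫ t, ∫ lam, multiSum (weightAt w lam) (fun y => cellIndicator (y 0 - t) * G y) ∂μ =
      ∫ lam, multiSum (weightAt w lam) G ∂μ := by
  obtain ⟨B, hB⟩ := hG.exists_norm_le
  obtain ⟨L, hL⟩ := hG.boundedSupport
  have hmeas : Measurable G := hG.measurable
  rw [hμ.integral_multiSum_swap w (by simp only [Function.uncurry_def]; fun_prop)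
    (fun t y => (norm_cellIndicator_mul_le (y 0 - t) _).trans (hB y))
    (isBounded_box d (L + 2)).measure_lt_top.ne
    (fun t y => mem_box_of_cellIndicator_sub_mul_ne_zero hL)
    fun t y hy => hL y (mul_ne_zero_iff.1 hy).2]
  simp only [integral_mul_const, integral_sub_left_eq_self, integral_cellIndicator, one_mul]

/-- By stationarity the correlations determine the moments: averaging `G` over translates and
anchoring the result in the unit cell does not change the expectation of its multiple sum. -/
theorem corrFunctional_reduceMap (hμ : IsProcess μ) (w : Fin m → ℝ)
    (G : C_c(Fin (n + 1) → Pos d, ℂ)) :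
    corrFunctional hμ w n (reduceMap G) = ∫ lam, multiSum (weightAt w lam) G ∂μ := by
  have hG := isTestFunction_coe G
  have hmeas : Measurable G := hG.measurable
  obtain ⟨B, hB⟩ := hG.exists_norm_le
  obtain ⟨L, hL⟩ := hG.boundedSupport
  have hmem : ∀ t (y : Fin (n + 1) → Pos d), (cellIndicator (y 0) * G fun j => y j + t) ≠ 0 →
      t ∈ box d (L + 2) := fun t y hy =>
    mem_box_of_cellIndicator_sub_mul_ne_zero hL (y := fun j => y j + t) (by simpa using hy)
  calc corrFunctional hμ w n (reduceMap G)
      = ∫ lam, multiSum (weightAt w lam)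
          (fun y => ∫ t, cellIndicator (y 0) * G fun j => y j + t) ∂μ := by
        simp only [← cellAnchored_reduceFun]
        rfl
    _ = ∫ t, ∫ lam, multiSum (weightAt w lam)
          (fun y => cellIndicator (y 0) * G fun j => y j + t) ∂μ := by
        refine (hμ.integral_multiSum_swap w (L := L + (L + 2 + 1))
          (by simp only [Function.uncurry_def]; fun_prop)
          (fun t y => (norm_cellIndicator_mul_le (y 0) _).trans (hB _))
          (isBounded_box d _).measure_lt_top.ne hmem fun t y hy j => ?_).symm
        simpa using add_mem_box (hL _ (mul_ne_zero_iff.1 hy).2 j) (neg_mem_box (hmem t y hy))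
    _ = ∫ t, ∫ lam, multiSum (weightAt w lam) (fun y => cellIndicator (y 0 - t) * G y) ∂μ := by
        congr 1 with t
        have htest : IsTestFunction fun y => cellIndicator (y 0 - t) * G y :=
          ⟨by fun_prop, ⟨B, fun y => (norm_cellIndicator_mul_le (y 0 - t) _).trans (hB y)⟩,
            L, fun y hy => hL y (mul_ne_zero_iff.1 hy).2⟩
        simpa using hμ.integral_multiSum_translate w htest t
    _ = ∫ lam, multiSum (weightAt w lam) G ∂μ :=
        hμ.integral_multiSum_cellIndicator_sub_mul w hG

end Moments

end ColouredPointProcess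

section CharacteristicFunctional

lemma measure_pi_ext_of_integral_exp {ι : Type*} {P Q : Measure (ι → ℝ)} [IsFiniteMeasure P]
    [IsFiniteMeasure Q] (h : ∀ (J : Finset ι) (c : J → ℝ),
      ∫ v, Complex.exp ((∑ j, c j * v j : ℝ) * Complex.I) ∂P =
        ∫ v, Complex.exp ((∑ j, c j * v j : ℝ) * Complex.I) ∂Q) : P = Q := by
  classical
  refine IsProjectiveLimit.unique (P := fun J => Q.map J.restrict) (fun J => ?_) fun J => rfl
  refine Measure.ext_of_charFunDual (funext fun l => ?_)
  have hcoord : ∀ v, l v = ∑ j, l (fun i => if j = i then 1 else 0) * v j := fun v => by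
    simp only [mul_comm _ (v _)]
    exact LinearMap.pi_apply_eq_sum_univ l.toLinearMap v
  have hchar : ∀ M : Measure (ι → ℝ), charFunDual (M.map J.restrict) l =
      ∫ v, Complex.exp ((∑ j : J, l (fun i => if j = i then 1 else 0) * v j : ℝ) * Complex.I) ∂M :=
    fun M => by
      rw [charFunDual_apply, integral_map (Finset.measurable_restrict J).aemeasurable
        (Continuous.aestronglyMeasurable (by fun_prop))]
      exact integral_congr_ae (Eventually.of_forall fun v => by dsimp only; rw [hcoord]; rfl)
  rw [hchar, hchar, h]

end CharacteristicFunctional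

section RandomMeasure

lemma exists_tendsto_indicator_of_isCompact {E : Type*} [TopologicalSpace E] [T2Space E]
    [LocallyCompactSpace E] [HasOuterApproxClosed E] {K : Set E} (hK : IsCompact K) :
    ∃ (f : ℕ → C_c(E, ℝ)) (g : C_c(E, ℝ)), (∀ k x, ‖f k x‖ ≤ g x) ∧
      ∀ x, Tendsto (fun k => f k x) atTop (𝓝 (K.indicator 1 x)) := by
  obtain ⟨χ, hχK, -, hχ, hχ01⟩ :=
    exists_continuous_one_zero_of_isCompact hK isClosed_empty (Set.disjoint_empty K)
  let f : ℕ → C_c(E, ℝ) := fun k =>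
    { toFun x := hK.isClosed.apprSeq k x * χ x
      hasCompactSupport' := hχ.mul_left }
  refine ⟨f, ⟨χ, hχ⟩, fun k x => ?_, fun x => ?_⟩
  · have hχx := (hχ01 x).1
    refine (Real.norm_of_nonneg (mul_nonneg (NNReal.coe_nonneg _) hχx)).trans_le ?_
    exact mul_le_of_le_one_left hχx (mod_cast HasOuterApproxClosed.apprSeq_apply_le_one _ k x)
  · have hlim := NNReal.tendsto_coe.2
      (tendsto_pi_nhds.1 (HasOuterApproxClosed.tendsto_apprSeq hK.isClosed) x)
    have hvalue : K.indicator (1 : E → ℝ) x = (K.indicator (fun _ => 1) x : NNReal) * χ x := by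
      by_cases hx : x ∈ K
      · simp [hx, hχK hx]
      · simp [hx]
    rw [hvalue]
    exact hlim.mul_const _

variable {E Ω : Type*} [TopologicalSpace E] [MeasurableSpace E] [BorelSpace E] [MeasurableSpace Ω]
  {κ : Ω → Measure E} [∀ ω, IsFiniteMeasureOnCompacts (κ ω)]

lemma measurable_integral_of_measurable (hκ : Measurable κ) (f : C_c(E, ℝ)) :
    Measurable fun ω => ∫ x, f x ∂κ ω := by
  have hint : ∀ ω, Integrable f (κ ω) := fun ω =>
    f.continuous.integrable_of_hasCompactSupport f.hasCompactSupport
  simp only [integral_eq_lintegral_pos_part_sub_lintegral_neg_part (hint _)]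
  have hf : Measurable f := f.continuous.measurable
  exact ((Measure.measurable_lintegral (by fun_prop)).comp hκ).ennreal_toReal.sub
    ((Measure.measurable_lintegral (by fun_prop)).comp hκ).ennreal_toReal

variable [T2Space E] [LocallyCompactSpace E] [HasOuterApproxClosed E]

lemma measurable_measure_of_isCompact
    (hκ : ∀ f : C_c(E, ℝ), Measurable fun ω => ∫ x, f x ∂κ ω) {K : Set E} (hK : IsCompact K) :
    Measurable fun ω => κ ω K := by
  obtain ⟨f, g, hfg, hf⟩ := exists_tendsto_indicator_of_isCompact hK
  have hlim : ∀ ω, Tendsto (fun k => ∫ x, f k x ∂κ ω) atTop (𝓝 ((κ ω).real K)) := fun ω => by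
    rw [← integral_indicator_one hK.measurableSet]
    exact tendsto_integral_of_dominated_convergence g
      (fun k => ((f k).continuous.integrable_of_hasCompactSupport
        (f k).hasCompactSupport).aestronglyMeasurable)
      (g.continuous.integrable_of_hasCompactSupport g.hasCompactSupport)
      (fun k => Eventually.of_forall (hfg k)) (Eventually.of_forall hf)
  have hreal : Measurable fun ω => (κ ω).real K :=
    measurable_of_tendsto_metrizable (fun k => hκ (f k)) (tendsto_pi_nhds.2 hlim)
  simpa only [measureReal_def, ENNReal.ofReal_toReal hK.measure_ne_top] using hreal.ennreal_ofReal

lemma measurable_restrict_of_isCompact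
    (hκ : ∀ f : C_c(E, ℝ), Measurable fun ω => ∫ x, f x ∂κ ω) {K : Set E} (hK : IsCompact K) :
    Measurable fun ω => (κ ω).restrict K := by
  have hfin : ∀ ω, IsFiniteMeasure ((κ ω).restrict K) := fun ω =>
    isFiniteMeasure_restrict.2 hK.measure_ne_top
  have hclosed : ∀ F : Set E, IsClosed F → Measurable fun ω => (κ ω).restrict K F := fun F hF => by
    simp only [Measure.restrict_apply hF.measurableSet]
    exact measurable_measure_of_isCompact hκ (hK.inter_left hF)
  exact Measurable.measure_of_isPiSystem
    (BorelSpace.measurable_eq.trans borel_eq_generateFrom_isClosed)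
    isPiSystem_isClosed hclosed (hclosed _ isClosed_univ)

variable [SigmaCompactSpace E]

theorem measurable_of_measurable_integral
    (hκ : ∀ f : C_c(E, ℝ), Measurable fun ω => ∫ x, f x ∂κ ω) : Measurable κ := by
  let K : CompactExhaustion E := default
  refine Measure.measurable_of_measurable_coe _ fun A hA => ?_
  have hsup : ∀ ω, κ ω A = ⨆ k, (κ ω).restrict (K k) A := fun ω => by
    rw [← Measure.restrict_iUnion_apply_eq_iSup (directed_of_isDirected_le K.subset) hA,
      K.iUnion_eq, Measure.restrict_univ]
  simp only [hsup]
  exact Measurable.iSup fun k =>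
    (Measure.measurable_coe hA).comp (measurable_restrict_of_isCompact hκ (K.isCompact k))

theorem map_eq_of_integral_exp_integral_eq {P Q : Measure Ω} [IsFiniteMeasure P]
    [IsFiniteMeasure Q] (hκ : Measurable κ) (h : ∀ f : C_c(E, ℝ),
      ∫ ω, Complex.exp ((∫ x, f x ∂κ ω : ℝ) * Complex.I) ∂P =
        ∫ ω, Complex.exp ((∫ x, f x ∂κ ω : ℝ) * Complex.I) ∂Q) : P.map κ = Q.map κ := by
  let Φ : Ω → C_c(E, ℝ) → ℝ := fun ω f => ∫ x, f x ∂κ ω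
  have hΦ : Measurable Φ := measurable_pi_lambda _ (measurable_integral_of_measurable hκ)
  have hlin : ∀ (J : Finset C_c(E, ℝ)) (c : J → ℝ) ω,
      ∑ j, c j * Φ ω j = ∫ x, (∑ j, c j • (j : C_c(E, ℝ))) x ∂κ ω := by
    intro J c ω
    have hint : ∀ f : C_c(E, ℝ), Integrable f (κ ω) := fun f =>
      f.continuous.integrable_of_hasCompactSupport f.hasCompactSupport
    simp only [Φ, CompactlySupportedContinuousMap.sum_apply,
      CompactlySupportedContinuousMap.smul_apply, smul_eq_mul]
    rw [integral_finsetSum _ fun j _ => (hint j.1).const_mul (c j)]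
    simp only [integral_const_mul]
  have hmap : P.map Φ = Q.map Φ := by
    refine measure_pi_ext_of_integral_exp fun J c => ?_
    have hmeas : ∀ M : Measure (C_c(E, ℝ) → ℝ), AEStronglyMeasurable (fun v : C_c(E, ℝ) → ℝ =>
        Complex.exp ((∑ j : J, c j * v j : ℝ) * Complex.I)) M := fun M =>
      Measurable.aestronglyMeasurable (by fun_prop)
    rw [integral_map hΦ.aemeasurable (hmeas _), integral_map hΦ.aemeasurable (hmeas _)]
    simp only [hlin, h]
  have hκΦ : Measurable[MeasurableSpace.comap Φ inferInstance] κ :=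
    @measurable_of_measurable_integral E Ω _ _ _ (MeasurableSpace.comap Φ inferInstance) κ
      _ _ _ _ _ fun f => (measurable_pi_apply f).comp (comap_measurable Φ)
  ext A hA
  obtain ⟨D, hD, hDA⟩ := hκΦ hA
  rw [Measure.map_apply hκ hA, Measure.map_apply hκ hA, ← hDA, ← Measure.map_apply hΦ hD,
    ← Measure.map_apply hΦ hD, hmap]

end RandomMeasure

section Exponential

lemma hasSum_integral_exp {Ω : Type*} [MeasurableSpace Ω] {P : Measure Ω} [IsFiniteMeasure P]
    {Y : Ω → ℂ} (hY : Measurable Y) {B : ℝ} (hB : ∀ ω, ‖Y ω‖ ≤ B) :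
    HasSum (fun k : ℕ => ∫ ω, Y ω ^ k / (k.factorial : ℂ) ∂P) (∫ ω, Complex.exp (Y ω) ∂P) := by
  refine hasSum_integral_of_dominated_convergence (fun k _ => B ^ k / (k.factorial : ℝ))
    (fun k => ((hY.pow_const k).div_const _).aestronglyMeasurable)
    (fun k => Eventually.of_forall fun ω => ?_)
    (Eventually.of_forall fun _ => Real.summable_pow_div_factorial B) (integrable_const _)
    (Eventually.of_forall fun ω => ?_)
  · rw [norm_div, norm_pow, Complex.norm_natCast]
    gcongr
    exact hB ω
  · rw [Complex.exp_eq_exp_ℂ]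
    exact NormedSpace.expSeries_div_hasSum_exp (Y ω)

lemma integral_exp_eq_of_integral_pow_eq {Ω : Type*} [MeasurableSpace Ω] {P Q : Measure Ω}
    [IsFiniteMeasure P] [IsFiniteMeasure Q] {Y : Ω → ℂ} (hY : Measurable Y) {B : ℝ}
    (hB : ∀ ω, ‖Y ω‖ ≤ B) (h : ∀ k : ℕ, ∫ ω, Y ω ^ k ∂P = ∫ ω, Y ω ^ k ∂Q) :
    ∫ ω, Complex.exp (Y ω) ∂P = ∫ ω, Complex.exp (Y ω) ∂Q := by
  refine (hasSum_integral_exp hY hB).unique ((hasSum_integral_exp hY hB).congr_fun ?_)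
  simp only [integral_div, h, implies_true]

end Exponential

namespace ColouredPointProcess

section Algebra

variable {d m : ℕ} {r : ℝ} {μ ν : Measure (Measure (ColPt d m))} {w : Fin m → ℝ}

/-- The random variables given by multiple sums over at least two points, which are the ones whose
expectations are determined by the correlations. -/
def multiSumSet (d : ℕ) (r : ℝ) (w : Fin m → ℝ) : Set (Measure (ColPt d m) → ℂ) :=
  {Ψ | ∃ (n : ℕ) (G : C_c(Fin (n + 2) → Pos d, ℂ)),
    Ψ = (uniformlyDiscrete d m r).indicator fun lam => multiSum (weightAt w lam) G}

/-- The algebra of random variables spanned by the multiple sums over at least two points. -/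
def multiSumSpan (d : ℕ) (r : ℝ) (w : Fin m → ℝ) : Submodule ℂ (Measure (ColPt d m) → ℂ) :=
  Submodule.span ℂ (multiSumSet d r w)

lemma mul_mem_multiSumSet (hr : 0 < r) {Ψ Ψ' : Measure (ColPt d m) → ℂ}
    (h : Ψ ∈ multiSumSet d r w) (h' : Ψ' ∈ multiSumSet d r w) : Ψ * Ψ' ∈ multiSumSet d r w := by
  obtain ⟨n, G, rfl⟩ := h
  obtain ⟨n', G', rfl⟩ := h'
  let e : Fin (n + n' + 2 + 2) ≃ Fin (n + 2) ⊕ Fin (n' + 2) :=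
    (finCongr (by omega)).trans finSumFinEquiv.symm
  let H : (Fin (n + 2) ⊕ Fin (n' + 2) → Pos d) → ℂ := fun y =>
    G (y ∘ Sum.inl) * G' (y ∘ Sum.inr)
  have hGb := (isTestFunction_coe G).boundedSupport
  have hGb' := (isTestFunction_coe G').boundedSupport
  have hbounded : BoundedSupport fun y => H (y ∘ e.symm) := by
    obtain ⟨L, hL⟩ := hGb
    obtain ⟨L', hL'⟩ := hGb'
    refine ⟨max L L', fun y hy => e.symm.surjective.forall.2 ?_⟩
    obtain ⟨hy₁, hy₂⟩ := mul_ne_zero_iff.1 hy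
    rintro (i | i)
    · exact box_mono (le_max_left _ _) (hL _ hy₁ i)
    · exact box_mono (le_max_right _ _) (hL' _ hy₂ i)
  refine ⟨n + n' + 2, ⟨⟨fun y => H (y ∘ e.symm), by fun_prop⟩, hbounded.hasCompactSupport⟩, ?_⟩
  ext lam
  by_cases hl : lam ∈ uniformlyDiscrete d m r
  · simp only [Pi.mul_apply, Set.indicator_of_mem hl]
    exact ((sparse_weightAt hl hr w).multiSum_mul hGb hGb').trans (multiSum_reindex _ e H).symm
  · simp [Set.indicator_of_notMem hl]

lemma mul_mem_multiSumSpan (hr : 0 < r) {Ψ Ψ' : Measure (ColPt d m) → ℂ}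
    (h : Ψ ∈ multiSumSpan d r w) (h' : Ψ' ∈ multiSumSpan d r w) : Ψ * Ψ' ∈ multiSumSpan d r w := by
  have hmul := Submodule.mul_mem_mul h h'
  rw [multiSumSpan, Submodule.span_mul_span] at hmul
  refine Submodule.span_mono ?_ hmul
  rintro _ ⟨Φ, hΦ, Φ', hΦ', rfl⟩
  exact mul_mem_multiSumSet hr hΦ hΦ'

lemma pow_succ_mem_multiSumSpan (hr : 0 < r) {Ψ : Measure (ColPt d m) → ℂ}
    (h : Ψ ∈ multiSumSpan d r w) (k : ℕ) : Ψ ^ (k + 1) ∈ multiSumSpan d r w := by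
  induction k with
  | zero => simpa using h
  | succ k ih =>
    rw [pow_succ]
    exact mul_mem_multiSumSpan hr ih h

lemma measurable_of_mem_multiSumSpan (hr : 0 < r) {Ψ : Measure (ColPt d m) → ℂ}
    (h : Ψ ∈ multiSumSpan d r w) : Measurable Ψ := by
  induction h using Submodule.span_induction with
  | mem Ψ h =>
    obtain ⟨n, G, rfl⟩ := h
    exact measurable_indicator_multiSum_of_isTestFunction hr w (isTestFunction_coe G)
  | zero => exact measurable_const
  | add Ψ Ψ' _ _ h h' => exact h.add h'
  | smul a Ψ _ h => exact h.const_smul a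

lemma exists_norm_le_of_mem_multiSumSpan (hr : 0 < r) {Ψ : Measure (ColPt d m) → ℂ}
    (h : Ψ ∈ multiSumSpan d r w) : ∃ B, ∀ lam, ‖Ψ lam‖ ≤ B := by
  induction h using Submodule.span_induction with
  | mem Ψ h =>
    obtain ⟨n, G, rfl⟩ := h
    exact exists_norm_indicator_multiSum_le hr w (isTestFunction_coe G)
  | zero => exact ⟨0, fun _ => norm_zero.le⟩
  | add Ψ Ψ' _ _ h h' =>
    obtain ⟨B, hB⟩ := h
    obtain ⟨B', hB'⟩ := h'
    exact ⟨B + B', fun lam => norm_add_le_of_le (hB lam) (hB' lam)⟩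
  | smul a Ψ _ h =>
    obtain ⟨B, hB⟩ := h
    exact ⟨‖a‖ * B, fun lam => (norm_smul_le a (Ψ lam)).trans
      (mul_le_mul_of_nonneg_left (hB lam) (norm_nonneg a))⟩

lemma integrable_of_mem_multiSumSpan [IsFiniteMeasure μ] (hr : 0 < r)
    {Ψ : Measure (ColPt d m) → ℂ} (h : Ψ ∈ multiSumSpan d r w) : Integrable Ψ μ := by
  obtain ⟨B, hB⟩ := exists_norm_le_of_mem_multiSumSpan hr h
  exact Integrable.of_bound (measurable_of_mem_multiSumSpan hr h).aestronglyMeasurable B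
    (Eventually.of_forall hB)

lemma integral_eq_of_mem_multiSumSpan (hμ : IsProcess μ) (hν : IsProcess ν) (hr : 0 < r)
    (hUμ : ∀ᵐ lam ∂μ, lam ∈ uniformlyDiscrete d m r)
    (hUν : ∀ᵐ lam ∂ν, lam ∈ uniformlyDiscrete d m r)
    (hγ : ∀ n, 1 ≤ n → corrFunctional hμ w n = corrFunctional hν w n)
    {Ψ : Measure (ColPt d m) → ℂ} (h : Ψ ∈ multiSumSpan d r w) :
    ∫ lam, Ψ lam ∂μ = ∫ lam, Ψ lam ∂ν := by
  have hμprob := hμ.prob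
  have hνprob := hν.prob
  induction h using Submodule.span_induction with
  | mem Ψ h =>
    obtain ⟨n, G, rfl⟩ := h
    rw [integral_congr_ae (indicator_ae_eq_self hUμ _),
      integral_congr_ae (indicator_ae_eq_self hUν _), ← corrFunctional_reduceMap hμ,
      ← corrFunctional_reduceMap hν, hγ (n + 1) n.succ_pos]
  | zero => simp
  | add Ψ Ψ' h h' ih ih' =>
    simp only [Pi.add_apply]
    rw [integral_add (integrable_of_mem_multiSumSpan hr h) (integrable_of_mem_multiSumSpan hr h'),
      integral_add (integrable_of_mem_multiSumSpan hr h) (integrable_of_mem_multiSumSpan hr h'),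
      ih, ih']
  | smul a Ψ _ ih => simp only [Pi.smul_apply, integral_smul, ih]

theorem integral_exp_eq_of_mem_multiSumSpan (hμ : IsProcess μ) (hν : IsProcess ν) (hr : 0 < r)
    (hUμ : ∀ᵐ lam ∂μ, lam ∈ uniformlyDiscrete d m r)
    (hUν : ∀ᵐ lam ∂ν, lam ∈ uniformlyDiscrete d m r)
    (hγ : ∀ n, 1 ≤ n → corrFunctional hμ w n = corrFunctional hν w n)
    {Ψ : Measure (ColPt d m) → ℂ} (h : Ψ ∈ multiSumSpan d r w) :
    ∫ lam, Complex.exp (Ψ lam) ∂μ = ∫ lam, Complex.exp (Ψ lam) ∂ν := by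
  have hμprob := hμ.prob
  have hνprob := hν.prob
  obtain ⟨B, hB⟩ := exists_norm_le_of_mem_multiSumSpan hr h
  refine integral_exp_eq_of_integral_pow_eq (measurable_of_mem_multiSumSpan hr h) hB fun k => ?_
  cases k with
  | zero => simp
  | succ k =>
    exact integral_eq_of_mem_multiSumSpan hμ hν hr hUμ hUν hγ (pow_succ_mem_multiSumSpan hr h k)

end Algebra

end ColouredPointProcess

namespace ColouredPointProcess

section LinearStatistics

variable {d m : ℕ} {r : ℝ} {lam : Measure (ColPt d m)} {w : Fin m → ℝ}

lemma uniformlyDiscrete_anti {s : ℝ} (h : r ≤ s) :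
    uniformlyDiscrete d m s ⊆ uniformlyDiscrete d m r := fun _ hl =>
  ⟨hl.1, fun a => (measure_mono fun _ hp k => (hp k).trans_le (by linarith)).trans (hl.2 a)⟩

lemma IsPointMeasure.isFiniteMeasureOnCompacts (h : IsPointMeasure lam) :
    IsFiniteMeasureOnCompacts lam where
  lt_top_of_isCompact K hK := by
    obtain ⟨k, hk⟩ := h K hK.measurableSet hK.closure
    exact hk ▸ ENNReal.natCast_lt_top k

/-- The polynomial `q` with `w j ^ 2 * q (w j) = 1` for `j = i` and `0` otherwise. The factor
`w j ^ 2` makes the multiplicity of colour `i` a combination of powers `≥ 2` of the weight, that is,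
of sums over at least two points. -/
def colourPoly (w : Fin m → ℝ) (i : Fin m) : Polynomial ℝ :=
  Lagrange.interpolate Finset.univ w (Pi.single i (w i ^ 2)⁻¹)

lemma measureReal_singleton_eq_colourPoly (hl : lam ∈ uniformlyDiscrete d m r) (hr : 0 < r)
    (hw : Function.Injective w) (hw0 : ∀ i, w i ≠ 0) (x : Pos d) (i : Fin m) :
    lam.real {(x, i)} = weightAt w lam x ^ 2 * (colourPoly w i).eval (weightAt w lam x) := by
  by_cases h : ∃ j, lam {(x, j)} ≠ 0
  · obtain ⟨j, hj⟩ := h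
    rw [weightAt_of_atom hl hr w hj, colourPoly,
      Lagrange.eval_interpolate_at_node _ hw.injOn (Finset.mem_univ j)]
    by_cases hji : j = i
    · subst hji
      rw [Pi.single_eq_same, mul_inv_cancel₀ (pow_ne_zero 2 (hw0 j)), measureReal_def,
        measure_singleton_eq_one hl hr hj, ENNReal.toReal_one]
    · have hi : lam {(x, i)} = 0 := by
        by_contra hi
        have hpq := eq_of_sub_mem_cube hl hr hj hi (by simpa using mem_cube_zero hr)
        exact hji (congrArg Prod.snd hpq)
      rw [Pi.single_eq_of_ne hji, mul_zero, measureReal_def, hi, ENNReal.toReal_zero]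
  · push Not at h
    rw [weightAt_of_no_atom w h, measureReal_def, h i, ENNReal.toReal_zero]
    simp

lemma exists_diagonal (hr : 0 < r) {f : Pos d → ℝ} (hf : Continuous f) (hfc : HasCompactSupport f)
    (n : ℕ) : ∃ G : C_c(Fin (n + 1) → Pos d, ℂ), (∀ x, G (fun _ => x) = (f x : ℂ)) ∧
      ∀ y, G y ≠ 0 → ∀ j, y j - y 0 ∈ cube d r := by
  obtain ⟨φ, hφ1, hφ0, -, -⟩ := exists_continuous_one_zero_of_isCompact
    (isCompact_singleton (x := (0 : Pos d))) (isOpen_cube d r).isClosed_compl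
    (Set.disjoint_compl_right_iff_subset.2 (Set.singleton_subset_iff.2 (mem_cube_zero hr)))
  obtain ⟨L, hL⟩ := exists_subset_box hfc.isCompact.isBounded
  let G : (Fin (n + 1) → Pos d) → ℂ := fun y => ((f (y 0) * ∏ j, φ (y j - y 0) : ℝ) : ℂ)
  have hG : ∀ y, G y ≠ 0 → f (y 0) ≠ 0 ∧ ∀ j, y j - y 0 ∈ cube d r := fun y hy => by
    obtain ⟨hfy, hφy⟩ := mul_ne_zero_iff.1 (Complex.ofReal_ne_zero.1 hy)
    refine ⟨hfy, fun j => ?_⟩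
    by_contra hj
    exact Finset.prod_ne_zero_iff.1 hφy j (Finset.mem_univ j) (hφ0 hj)
  have hbounded : BoundedSupport G := ⟨_, fun y hy j => by
    simpa using add_mem_box (hL (subset_tsupport f (hG y hy).1))
      (cube_subset_box d r ((hG y hy).2 j))⟩
  refine ⟨⟨⟨G, by fun_prop⟩, hbounded.hasCompactSupport⟩, fun x => ?_, fun y hy => (hG y hy).2⟩
  have hφ : φ 0 = 1 := hφ1 rfl
  simp [G, hφ]

lemma multiSum_eq_sum_diagonal (hl : lam ∈ uniformlyDiscrete d m r) (hr : 0 < r) {n : ℕ}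
    {G : (Fin (n + 1) → Pos d) → ℂ} (hG : ∀ y, G y ≠ 0 → ∀ j, y j - y 0 ∈ cube d r)
    {P : Finset (Pos d)} (hP : ∀ x i, G (fun _ => x) ≠ 0 → lam {(x, i)} ≠ 0 → x ∈ P) :
    multiSum (weightAt w lam) G = ∑ x ∈ P, (weightAt w lam x : ℂ) ^ (n + 1) * G fun _ => x := by
  classical
  rw [multiSum_eq_sum_of_subset (P.image fun x _ => x) fun y hGy hy => ?_,
    Finset.sum_image fun x _ y _ hxy => congrFun hxy 0]
  · simp
  · obtain ⟨i, hi⟩ := exists_atom_of_weightAt_ne_zero (hy 0)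
    have hconst : (fun _ => y 0) = y := funext fun j => by
      obtain ⟨k, hk⟩ := exists_atom_of_weightAt_ne_zero (hy j)
      exact congrArg Prod.fst (eq_of_sub_mem_cube hl hr hi hk (hG y hGy j))
    exact Finset.mem_image.2 ⟨y 0, hP _ i (by rwa [hconst]) hi, hconst⟩

lemma integral_eq_sum_colours (hl : lam ∈ uniformlyDiscrete d m r) (f : C_c(ColPt d m, ℝ)) {L : ℕ}
    (hf : ∀ p, f p ≠ 0 → p ∈ colBox d m L) {P : Finset (Pos d)}
    (hP : ∀ x ∈ box d L, ∀ i, lam {(x, i)} ≠ 0 → x ∈ P) :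
    ∫ p, f p ∂lam = ∑ x ∈ P, ∑ i, lam.real {(x, i)} * f (x, i) := by
  have hcompacts := hl.1.isFiniteMeasureOnCompacts
  have hint : Integrable f lam :=
    f.continuous.integrable_of_hasCompactSupport f.hasCompactSupport
  have hzero : ∀ᵐ p ∂lam, p ∉ ((P ×ˢ Finset.univ : Finset (ColPt d m)) : Set _) → f p = 0 := by
    filter_upwards [(ae_restrict_iff' (measurableSet_colBox d m L)).1
      (measure_eq_zero_iff_ae_notMem.1 (restrict_colBox_compl_eq_zero hl hP))] with p hp hpA
    by_contra hfp
    exact hp (hf p hfp) hpA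
  rw [← setIntegral_eq_integral_of_ae_compl_eq_zero hzero, setIntegral_finset _ hint.integrableOn,
    Finset.sum_product]
  rfl

lemma ofReal_integral_eq_sum_multiSum (hl : lam ∈ uniformlyDiscrete d m r) (hr : 0 < r)
    (hw : Function.Injective w) (hw0 : ∀ i, w i ≠ 0) (f : C_c(ColPt d m, ℝ))
    {G : ∀ (_ : Fin m) (n : ℕ), (Fin (n + 2) → Pos d) → ℂ}
    (hconst : ∀ i n x, G i n (fun _ => x) = f (x, i))
    (hdiag : ∀ i n y, G i n y ≠ 0 → ∀ j, y j - y 0 ∈ cube d r) :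
    ((∫ p, f p ∂lam : ℝ) : ℂ) = ∑ i, ∑ n ∈ Finset.range ((colourPoly w i).natDegree + 1),
      ((colourPoly w i).coeff n : ℂ) * multiSum (weightAt w lam) (G i n) := by
  obtain ⟨L, hL⟩ := exists_subset_colBox (A := tsupport f)
    (by rw [(isClosed_tsupport f).closure_eq]; exact f.hasCompactSupport)
  have hf : ∀ p, f p ≠ 0 → p ∈ colBox d m L := fun p hp => hL (subset_tsupport f hp)
  obtain ⟨P, -, -, hP⟩ := exists_finset_colBox hl hr L
  have hsum : ∀ i n, multiSum (weightAt w lam) (G i n) =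
      ∑ x ∈ P, (weightAt w lam x : ℂ) ^ (n + 2) * f (x, i) := fun i n => by
    rw [multiSum_eq_sum_diagonal hl hr (hdiag i n) (P := P) fun x j hx hj => ?_]
    · simp only [hconst]
    · rw [hconst, Complex.ofReal_ne_zero] at hx
      exact hP x (hf _ hx) j hj
  simp only [hsum, integral_eq_sum_colours hl f hf hP]
  rw [Finset.sum_comm]
  norm_cast
  refine Finset.sum_congr rfl fun i _ => ?_
  simp only [Finset.mul_sum]
  rw [Finset.sum_comm]
  refine Finset.sum_congr rfl fun x _ => ?_
  rw [measureReal_singleton_eq_colourPoly hl hr hw hw0, Polynomial.eval_eq_sum_range,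
    Finset.mul_sum, Finset.sum_mul]
  exact Finset.sum_congr rfl fun n _ => by ring

lemma integral_mem_multiSumSpan (hr : 0 < r) (hw : Function.Injective w) (hw0 : ∀ i, w i ≠ 0)
    (f : C_c(ColPt d m, ℝ)) :
    ((uniformlyDiscrete d m r).indicator fun lam => ((∫ p, f p ∂lam : ℝ) : ℂ)) ∈
      multiSumSpan d r w := by
  have hslice (i : Fin m) : Topology.IsClosedEmbedding fun x : Pos d => (x, i) :=
    Function.LeftInverse.isClosedEmbedding (f := Prod.fst) (fun _ => rfl) continuous_fst
      (by fun_prop)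
  choose G hconst hdiag using fun (i : Fin m) (n : ℕ) =>
    exists_diagonal hr (f := fun x => f (x, i)) (by fun_prop)
      (f.hasCompactSupport.comp_isClosedEmbedding (hslice i)) (n + 1)
  have hcombination : ((uniformlyDiscrete d m r).indicator fun lam => ((∫ p, f p ∂lam : ℝ) : ℂ)) =
      ∑ i, ∑ n ∈ Finset.range ((colourPoly w i).natDegree + 1), ((colourPoly w i).coeff n : ℂ) •
        (uniformlyDiscrete d m r).indicator fun lam => multiSum (weightAt w lam) (G i n) := by
    ext lam
    simp only [Finset.sum_apply, Pi.smul_apply]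
    by_cases hl : lam ∈ uniformlyDiscrete d m r
    · simp only [Set.indicator_of_mem hl, smul_eq_mul]
      exact ofReal_integral_eq_sum_multiSum hl hr hw hw0 f hconst hdiag
    · simp [Set.indicator_of_notMem hl]
  rw [hcombination]
  exact Submodule.sum_mem _ fun i _ => Submodule.sum_mem _ fun n _ =>
    Submodule.smul_mem _ _ (Submodule.subset_span ⟨n, G i n, rfl⟩)

end LinearStatistics

section Uniqueness

variable {d m : ℕ} {r : ℝ} {μ ν : Measure (Measure (ColPt d m))} {w : Fin m → ℝ}

lemma isFiniteMeasureOnCompacts_indicator_id (lam : Measure (ColPt d m)) :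
    IsFiniteMeasureOnCompacts ((uniformlyDiscrete d m r).indicator id lam) := by
  by_cases hl : lam ∈ uniformlyDiscrete d m r
  · rw [Set.indicator_of_mem hl]
    exact hl.1.isFiniteMeasureOnCompacts
  · rw [Set.indicator_of_notMem hl]
    infer_instance

theorem eq_of_corrFunctional_eq (hμ : IsProcess μ) (hν : IsProcess ν) (hw : Function.Injective w)
    (hw0 : ∀ i, w i ≠ 0) (hγ : ∀ n, 1 ≤ n → corrFunctional hμ w n = corrFunctional hν w n) :
    μ = ν := by
  have hμprob := hμ.prob
  have hνprob := hν.prob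
  obtain ⟨r₁, hr₁, hU₁⟩ := hμ.unifDiscrete
  obtain ⟨r₂, hr₂, hU₂⟩ := hν.unifDiscrete
  have hr : 0 < min r₁ r₂ := lt_min hr₁ hr₂
  set U := uniformlyDiscrete d m (min r₁ r₂)
  have hUμ : ∀ᵐ lam ∂μ, lam ∈ U := hU₁.mono fun _ => (uniformlyDiscrete_anti (min_le_left _ _) ·)
  have hUν : ∀ᵐ lam ∂ν, lam ∈ U := hU₂.mono fun _ => (uniformlyDiscrete_anti (min_le_right _ _) ·)
  let κ : Measure (ColPt d m) → Measure (ColPt d m) := U.indicator id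
  have hκ : Measurable κ := measurable_id.indicator (measurableSet_uniformlyDiscrete d m _)
  have hfinite : ∀ lam, IsFiniteMeasureOnCompacts (κ lam) := isFiniteMeasureOnCompacts_indicator_id
  have hmap : μ.map κ = ν.map κ := map_eq_of_integral_exp_integral_eq hκ fun f => by
    have hstatistic : ∀ lam, ((∫ p, f p ∂κ lam : ℝ) : ℂ) =
        U.indicator (fun lam => ((∫ p, f p ∂lam : ℝ) : ℂ)) lam := fun lam => by
      by_cases hl : lam ∈ U <;> simp [κ, hl]
    have hmem := Submodule.smul_mem _ Complex.I (integral_mem_multiSumSpan hr hw hw0 f)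
    simpa only [hstatistic, Pi.smul_apply, smul_eq_mul, mul_comm Complex.I] using
      integral_exp_eq_of_mem_multiSumSpan hμ hν hr hUμ hUν hγ hmem
  rwa [Measure.map_congr (indicator_ae_eq_self hUμ id), Measure.map_id,
    Measure.map_congr (indicator_ae_eq_self hUν id), Measure.map_id] at hmap

end Uniqueness

end ColouredPointProcess

end

/-- The weighted correlations of `μ`-almost every `lam` exist and do not depend on `lam`; and `μ` is
the only process for which they occur as the correlations of a non-null set of configurations. -/
theorem theorem7p3 {d m : ℕ} (w : Fin m → ℝ) (hw : Function.Injective w) (hw0 : ∀ i, w i ≠ 0)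
    (μ : Measure (Measure (ColPt d m))) (hμ : IsProcess μ) :
    ∃ γ : (n : ℕ) → C_c(Fin n → Pos d, ℂ) →ₗ[ℂ] ℂ,
      (∀ᵐ lam ∂μ, ∀ n : ℕ, 1 ≤ n → IsCorrelation w lam n (γ n)) ∧
      ∀ ν : Measure (Measure (ColPt d m)), IsProcess ν →
        (∃ᵐ lam ∂ν, ∀ n : ℕ, 1 ≤ n → IsCorrelation w lam n (γ n)) → ν = μ := by
  refine ⟨corrFunctional hμ w,
    ae_all_iff.2 fun n => (hμ.ae_isCorrelation w n).mono fun _ h _ => h, fun ν hν hfreq => ?_⟩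
  have hae : ∀ᵐ lam ∂ν, ∀ n, IsCorrelation w lam n (corrFunctional hν w n) :=
    ae_all_iff.2 fun n => hν.ae_isCorrelation w n
  obtain ⟨lam, h₁, h₂⟩ := (hfreq.and_eventually hae).exists
  refine (eq_of_corrFunctional_eq hμ hν hw hw0 fun n hn => ?_).symm
  exact LinearMap.ext fun f => tendsto_nhds_unique ((h₁ n hn).tendsto f) ((h₂ n).tendsto f)
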